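/- Let $\mathbb{F}$ be an algebraically closed field of characteristic zero, let $V=V_0\oplus V_1$ be a finite-dimensional superspace over $\mathbb{F}$ with $\dim V_0=m$ and $\dim V_1=2n$, and let $\varphi$ be a non-degenerate bilinear form on $V$ for which $V_0$ and $V_1$ are orthogonal and which is symmetric on $V_0$ and skew-symmetric on $V_1$. Let $\mathfrak{g}=\mathfrak{osp}(m|2n)=\mathfrak{g}_{\bar 0}\oplus\mathfrak{g}_{\bar 1}$ be the Lie superalgebra, under the supercommutator, with $$\mathfrak{g}_{i}=\{z\in\mathfrak{gl}(V)_i \mid \varphi(z(x),y)=-(-1)^{ij}\varphi(x,z(y))\ \text{for all } x\in V_j,\ j\in\mathbb{Z}/2,\ y\in V\}.$$ Let $e\in\mathfrak{g}_{\bar 0}$ be a nilpotent even element whose Jordan type on $V_0$ is the partition $p$ of $m$ and whose Jordan type on $V_1$ is the partition $q$ of $2n$, where $(p|q)$ is orthosymplectic, i.e. every even part of $p$ has even multiplicity in $p$ and every odd part of $q$ has even multiplicity in $q$. Let $\mathfrak{s}=\{e,f,h\}\subset\mathfrak{g}_{\bar 0}$ be an $\mathfrak{sl}_2$-triple for $e$,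 i.e. $[e,f]=h$, $[h,e]=2e$, $[h,f]=-2f$ (with $e=h=f=0$ allowed), and let $\mathfrak{g}^{\mathfrak{s}}=\{z\in\mathfrak{g}\mid [e,z]=[h,z]=[f,z]=0\}$. Let $r_1>\dots>r_N$ be the distinct odd positive integers, and $s_1>\dots>s_T$ the distinct even positive integers, that occur as a part of $p$ or of $q$. Let $m_i$ and $2n_i$ be the multiplicities of $r_i$ in $p$ and in $q$, and let $2c_j$ and $d_j$ be the multiplicities of $s_j$ in $p$ and in $q$. Then there is an isomorphism of Lie superalgebras $$\mathfrak{g}^{\mathfrak{s}}\cong \mathfrak{osp}(m_1|2n_1)\times\cdots\times\mathfrak{osp}(m_N|2n_N)\times\mathfrak{osp}(d_1|2c_1)\times\cdots\times\mathfrak{osp}(d_T|2c_T).$$ -/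

import Mathlib

/-! ### Lie superalgebras -/

/-- The Koszul sign `(-1)^{ij}` of two parities. -/
def superSign (F : Type*) [Field F] (i j : ZMod 2) : F := (-1) ^ (i.val * j.val)

theorem parity_cases (i : ZMod 2) : i = 0 ∨ i = 1 := by revert i; decide

theorem superSign_zero_left (F : Type*) [Field F] (j : ZMod 2) : superSign F 0 j = 1 := by
  simp [superSign]

theorem superSign_zero_right (F : Type*) [Field F] (i : ZMod 2) : superSign F i 0 = 1 := by
  simp [superSign]

theorem superSign_one_one (F : Type*) [Field F] : superSign F 1 1 = -1 := by
  simp [superSign, ZMod.val_one]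

theorem assoc_super_skew {F A : Type*} [Field F] [Ring A] [Algebra F A] (i j : ZMod 2) (x y : A) :
    x * y - superSign F i j • (y * x) =
      -(superSign F i j • (y * x - superSign F j i • (x * y))) := by
  rcases parity_cases i with rfl | rfl <;> rcases parity_cases j with rfl | rfl <;>
    simp [superSign_zero_left, superSign_zero_right, superSign_one_one, add_comm]

theorem assoc_super_jacobi {F A : Type*} [Field F] [Ring A] [Algebra F A] (i j k : ZMod 2)
    (x y z : A) :
    x * (y * z - superSign F j k • (z * y)) -
        superSign F i (j + k) • ((y * z - superSign F j k • (z * y)) * x) =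
      (x * y - superSign F i j • (y * x)) * z -
          superSign F (i + j) k • (z * (x * y - superSign F i j • (y * x))) +
        superSign F i j • (y * (x * z - superSign F i k • (z * x)) -
          superSign F j (i + k) • ((x * z - superSign F i k • (z * x)) * y)) := by
  rcases parity_cases i with rfl | rfl <;> rcases parity_cases j with rfl | rfl <;>
    rcases parity_cases k with rfl | rfl <;>
    simp [superSign_zero_left, superSign_zero_right, superSign_one_one,
      show (1 : ZMod 2) + 1 = 0 from rfl] <;> noncomm_ring

/-- A Lie superalgebra over a field `F` (of characteristic zero, in the application):
a vector space `L = L₀ ⊕ L₁` with an even bilinear bracket which is super skew-symmetric and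
satisfies the super Jacobi identity. -/
class LieSuperalgebra (F L : Type*) [Field F] [AddCommGroup L] [Module F L] where
  /-- the homogeneous parts `L₀` and `L₁` -/
  part : ZMod 2 → Submodule F L
  /-- the bracket -/
  bracket : L →ₗ[F] L →ₗ[F] L
  isCompl : IsCompl (part 0) (part 1)
  bracket_mem : ∀ {i j : ZMod 2} {x y : L}, x ∈ part i → y ∈ part j →
    bracket x y ∈ part (i + j)
  skew : ∀ {i j : ZMod 2} {x y : L}, x ∈ part i → y ∈ part j →
    bracket x y = -(superSign F i j • bracket y x)
  jacobi : ∀ {i j : ZMod 2} {x y : L}, x ∈ part i → y ∈ part j → ∀ z : L,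
    bracket x (bracket y z) = bracket (bracket x y) z + superSign F i j • bracket y (bracket x z)

/-- The homogeneous part `L_i` of a Lie superalgebra. -/
abbrev superPart (F L : Type*) [Field F] [AddCommGroup L] [Module F L] [LieSuperalgebra F L]
    (i : ZMod 2) : Submodule F L := LieSuperalgebra.part i

/-- The bracket of a Lie superalgebra. -/
abbrev superBracket (F : Type*) {L : Type*} [Field F] [AddCommGroup L] [Module F L]
    [LieSuperalgebra F L] (x y : L) : L := LieSuperalgebra.bracket (F := F) x y

/-- An isomorphism of Lie superalgebras: a linear bijection that preserves the parity and the
bracket. -/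
structure LieSuperEquiv (F L M : Type*) [Field F] [AddCommGroup L] [Module F L]
    [AddCommGroup M] [Module F M] [LieSuperalgebra F L] [LieSuperalgebra F M]
    extends L ≃ₗ[F] M where
  map_part : ∀ (i : ZMod 2) (x : L), toFun x ∈ superPart F M i ↔ x ∈ superPart F L i
  map_bracket : ∀ x y : L,
    toFun (superBracket F x y) = superBracket F (toFun x) (toFun y)

/-- A sub-superalgebra of a Lie superalgebra: a graded subspace closed under the bracket. -/
structure LieSubsuperalgebra (F L : Type*) [Field F] [AddCommGroup L] [Module F L]
    [LieSuperalgebra F L] extends Submodule F L where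
  bracket_mem' : ∀ {x y : L}, x ∈ toSubmodule → y ∈ toSubmodule →
    superBracket F x y ∈ toSubmodule
  graded' : ∀ {x : L}, x ∈ toSubmodule →
    ∃ y z : L, y ∈ toSubmodule ∧ z ∈ toSubmodule ∧ y ∈ superPart F L 0 ∧ z ∈ superPart F L 1 ∧
      y + z = x

section Constructions

variable {F L M : Type*} [Field F] [AddCommGroup L] [Module F L] [LieSuperalgebra F L]
  [AddCommGroup M] [Module F M] [LieSuperalgebra F M]

instance LieSubsuperalgebra.instCoeSort : CoeSort (LieSubsuperalgebra F L) (Type _) :=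
  ⟨fun S => S.toSubmodule⟩

instance LieSubsuperalgebra.instAddCommGroup (S : LieSubsuperalgebra F L) :
    AddCommGroup S.toSubmodule := inferInstance

instance LieSubsuperalgebra.instModule (S : LieSubsuperalgebra F L) :
    Module F S.toSubmodule := inferInstance

/-- A sub-superalgebra is a Lie superalgebra with the restricted grading and bracket. -/
instance LieSubsuperalgebra.instLieSuperalgebra (S : LieSubsuperalgebra F L) :
    LieSuperalgebra F S.toSubmodule where
  part i := (superPart F L i).comap S.toSubmodule.subtype
  bracket := LinearMap.mk₂ F (fun x y => ⟨superBracket F (x : L) (y : L), S.bracket_mem' x.2 y.2⟩)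
    (by intros; ext; simp [superBracket]) (by intros; ext; simp [superBracket])
    (by intros; ext; simp [superBracket]) (by intros; ext; simp [superBracket])
  isCompl := by
    have h := LieSuperalgebra.isCompl (F := F) (L := L)
    constructor
    · rw [Submodule.disjoint_def]
      intro x h0 h1
      ext
      exact Submodule.disjoint_def.1 h.disjoint _ h0 h1
    · rw [codisjoint_iff, eq_top_iff]
      rintro ⟨x, hx⟩ -
      obtain ⟨y, z, hy, hz, hy0, hz1, rfl⟩ := S.graded' hx
      exact Submodule.mem_sup.2 ⟨⟨y, hy⟩, hy0, ⟨z, hz⟩, hz1, rfl⟩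
  bracket_mem hx hy := LieSuperalgebra.bracket_mem (F := F) (L := L) hx hy
  skew hx hy := Subtype.ext (LieSuperalgebra.skew (F := F) (L := L) hx hy)
  jacobi hx hy z := Subtype.ext (LieSuperalgebra.jacobi (F := F) (L := L) hx hy z)

/-- The product of a family of Lie superalgebras. -/
instance LieSuperalgebra.instPi {ι : Type*} {A : ι → Type*} [∀ i, AddCommGroup (A i)]
    [∀ i, Module F (A i)] [∀ i, LieSuperalgebra F (A i)] : LieSuperalgebra F (∀ i, A i) where
  part k := Submodule.pi Set.univ (fun i => superPart F (A i) k)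
  bracket := LinearMap.mk₂ F (fun x y i => superBracket F (x i) (y i))
    (by intros; ext; simp [superBracket]) (by intros; ext; simp [superBracket])
    (by intros; ext; simp [superBracket]) (by intros; ext; simp [superBracket])
  isCompl := by
    constructor
    · rw [Submodule.disjoint_def]
      intro x h0 h1
      funext i
      exact Submodule.disjoint_def.1 (LieSuperalgebra.isCompl (F := F) (L := A i)).disjoint _
        (h0 i trivial) (h1 i trivial)
    · rw [codisjoint_iff, eq_top_iff]
      intro x _
      have h : ∀ i, ∃ y ∈ superPart F (A i) 0, ∃ z ∈ superPart F (A i) 1, y + z = x i := fun i =>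
        Submodule.mem_sup.1 ((codisjoint_iff.1
          (LieSuperalgebra.isCompl (F := F) (L := A i)).codisjoint).symm ▸ Submodule.mem_top)
      choose y hy z hz hyz using h
      exact Submodule.mem_sup.2 ⟨y, fun i _ => hy i, z, fun i _ => hz i, funext hyz⟩
  bracket_mem hx hy := fun i _ => LieSuperalgebra.bracket_mem (hx i trivial) (hy i trivial)
  skew hx hy := funext fun i => LieSuperalgebra.skew (hx i trivial) (hy i trivial)
  jacobi hx hy z := funext fun i => LieSuperalgebra.jacobi (hx i trivial) (hy i trivial) (z i)

/-- The product of two Lie superalgebras. -/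
instance LieSuperalgebra.instProd : LieSuperalgebra F (L × M) where
  part k := (superPart F L k).prod (superPart F M k)
  bracket := LinearMap.mk₂ F (fun x y => (superBracket F x.1 y.1, superBracket F x.2 y.2))
    (by intros; simp [superBracket]) (by intros; simp [superBracket])
    (by intros; simp [superBracket]) (by intros; simp [superBracket])
  isCompl := by
    have hL := LieSuperalgebra.isCompl (F := F) (L := L)
    have hM := LieSuperalgebra.isCompl (F := F) (L := M)
    constructor
    · rw [Submodule.disjoint_def]
      intro x h0 h1
      exact Prod.ext (Submodule.disjoint_def.1 hL.disjoint _ h0.1 h1.1)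
        (Submodule.disjoint_def.1 hM.disjoint _ h0.2 h1.2)
    · rw [codisjoint_iff, Submodule.prod_sup_prod, codisjoint_iff.1 hL.codisjoint,
        codisjoint_iff.1 hM.codisjoint, Submodule.prod_top]
  bracket_mem hx hy := ⟨LieSuperalgebra.bracket_mem hx.1 hy.1,
    LieSuperalgebra.bracket_mem hx.2 hy.2⟩
  skew hx hy := Prod.ext (LieSuperalgebra.skew hx.1 hy.1) (LieSuperalgebra.skew hx.2 hy.2)
  jacobi hx hy z := Prod.ext (LieSuperalgebra.jacobi hx.1 hy.1 z.1)
    (LieSuperalgebra.jacobi hx.2 hy.2 z.2)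

/-- The centralizer `{z | [x, z] = 0 for all x ∈ X}` of a set `X` of even elements. -/
def evenCentralizer (X : Set L) (hX : ∀ x ∈ X, x ∈ superPart F L 0) :
    LieSubsuperalgebra F L where
  carrier := {z | ∀ x ∈ X, superBracket F x z = 0}
  add_mem' := by
    intro a b ha hb x hx
    simp only [map_add, ha x hx, hb x hx, add_zero]
  zero_mem' := by intro x _; simp
  smul_mem' := by
    intro c a ha x hx
    simp only [map_smul, ha x hx, smul_zero]
  bracket_mem' := by
    intro a b ha hb x hx
    have key : ∀ (k : ZMod 2) (y : L), y ∈ superPart F L k →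
        superBracket F x (superBracket F y b) = superBracket F (superBracket F x y) b := by
      intro k y hy
      have h := LieSuperalgebra.jacobi (F := F) (hX x hx) hy b
      have hb' : superBracket F x b = 0 := hb x hx
      simp only [superBracket] at hb' ⊢
      rw [h, hb']
      simp
    have ha' : superBracket F x a = 0 := ha x hx
    obtain ⟨y, hy, z, hz, rfl⟩ := Submodule.mem_sup.1
      ((codisjoint_iff.1 (LieSuperalgebra.isCompl (F := F) (L := L)).codisjoint).symm ▸
        (Submodule.mem_top : a ∈ _))
    have h0 := key 0 y hy
    have h1 := key 1 z hz
    simp only [superBracket, map_add, LinearMap.add_apply] at h0 h1 ha' ⊢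
    rw [h0, h1, ← LinearMap.add_apply, ← map_add, ha']
    simp
  graded' := by
    intro a ha
    have hc := LieSuperalgebra.isCompl (F := F) (L := L)
    obtain ⟨y, hy, z, hz, rfl⟩ := Submodule.mem_sup.1
      ((codisjoint_iff.1 hc.codisjoint).symm ▸ (Submodule.mem_top : a ∈ _))
    have key : ∀ x ∈ X, superBracket F x y = 0 ∧ superBracket F x z = 0 := by
      intro x hx
      have h : superBracket F x (y + z) = 0 := ha x hx
      have e0 : superBracket F x y ∈ superPart F L 0 := by
        simpa using LieSuperalgebra.bracket_mem (hX x hx) hy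
      have e1 : superBracket F x z ∈ superPart F L 1 := by
        simpa using LieSuperalgebra.bracket_mem (hX x hx) hz
      have hs : superBracket F x y = -superBracket F x z := by
        rw [eq_neg_iff_add_eq_zero, ← h]; simp
      have h0 : superBracket F x y = 0 :=
        Submodule.disjoint_def.1 hc.disjoint _ e0 (hs ▸ Submodule.neg_mem _ e1)
      refine ⟨h0, ?_⟩
      rw [h0] at hs
      exact neg_eq_zero.1 hs.symm
    exact ⟨y, z, fun x hx => (key x hx).1, fun x hx => (key x hx).2, hy, hz, rfl⟩

variable (F) in
/-- `e, h, f` is an `𝔰𝔩₂`-triple of even elements of `L`: `[e, f] = h`, `[h, e] = 2e` and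
`[h, f] = -2f`. In characteristic `0` these relations place `e, h, f` in `[L₀, L₀]`.
The zero triple, attached to `e = 0`, is allowed. -/
structure IsEvenSl2Triple (e h f : L) : Prop where
  even_e : e ∈ superPart F L 0
  even_h : h ∈ superPart F L 0
  even_f : f ∈ superPart F L 0
  bracket_e_f : superBracket F e f = h
  bracket_h_e : superBracket F h e = (2 : F) • e
  bracket_h_f : superBracket F h f = -((2 : F) • f)

/-- The centralizer `L^𝔰` of an `𝔰𝔩₂`-triple `𝔰 = {e, h, f}` of even elements. -/
def IsEvenSl2Triple.centralizer {e h f : L} (t : IsEvenSl2Triple F e h f) :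
    LieSubsuperalgebra F L :=
  evenCentralizer {e, h, f} (by
    rintro x (rfl | rfl | rfl)
    exacts [t.even_e, t.even_h, t.even_f])

end Constructions

/-! ### The general linear Lie superalgebra -/

section GeneralLinear

variable {F V₀ V₁ : Type*} [Field F] [AddCommGroup V₀] [Module F V₀] [AddCommGroup V₁]
  [Module F V₁]

variable (F V₀ V₁) in
/-- The homogeneous parts `V₀` and `V₁` of the superspace `V = V₀ ⊕ V₁`. -/
def vecPart (i : ZMod 2) : Submodule F (V₀ × V₁) :=
  if i = 0 then LinearMap.range (LinearMap.inl F V₀ V₁) else LinearMap.range (LinearMap.inr F V₀ V₁)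

variable (F V₀ V₁) in
/-- The endomorphisms of `V = V₀ ⊕ V₁` of parity `i`. -/
def endPart (i : ZMod 2) : Submodule F (Module.End F (V₀ × V₁)) where
  carrier := {z | ∀ j, ∀ x ∈ vecPart F V₀ V₁ j, z x ∈ vecPart F V₀ V₁ (i + j)}
  add_mem' ha hb j x hx := add_mem (ha j x hx) (hb j x hx)
  zero_mem' _ _ _ := Submodule.zero_mem _
  smul_mem' c _ ha j x hx := Submodule.smul_mem _ c (ha j x hx)

theorem mem_vecPart_zero {x : V₀ × V₁} : x ∈ vecPart F V₀ V₁ 0 ↔ x.2 = 0 := by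
  obtain ⟨a, b⟩ := x
  simp [vecPart, eq_comm]

theorem mem_vecPart_one {x : V₀ × V₁} : x ∈ vecPart F V₀ V₁ 1 ↔ x.1 = 0 := by
  obtain ⟨a, b⟩ := x
  simp [vecPart, eq_comm]

variable (F V₀ V₁) in
/-- The projection of `V` onto `V₀`, as an endomorphism of `V`. -/
def projZero : Module.End F (V₀ × V₁) := LinearMap.inl F V₀ V₁ ∘ₗ LinearMap.fst F V₀ V₁

variable (F V₀ V₁) in
/-- The projection of `V` onto `V₁`, as an endomorphism of `V`. -/
def projOne : Module.End F (V₀ × V₁) := LinearMap.inr F V₀ V₁ ∘ₗ LinearMap.snd F V₀ V₁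

/-- The even (block-diagonal) component of an endomorphism of `V₀ ⊕ V₁`. -/
def endEven (z : Module.End F (V₀ × V₁)) : Module.End F (V₀ × V₁) :=
  projZero F V₀ V₁ * z * projZero F V₀ V₁ + projOne F V₀ V₁ * z * projOne F V₀ V₁

/-- The odd (block-antidiagonal) component of an endomorphism of `V₀ ⊕ V₁`. -/
def endOdd (z : Module.End F (V₀ × V₁)) : Module.End F (V₀ × V₁) :=
  projZero F V₀ V₁ * z * projOne F V₀ V₁ + projOne F V₀ V₁ * z * projZero F V₀ V₁

theorem endEven_add_endOdd (z : Module.End F (V₀ × V₁)) : endEven z + endOdd z = z := by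
  apply LinearMap.ext
  rintro ⟨a, b⟩
  have h : z (a, b) = z (a, 0) + z (0, b) := by rw [← map_add]; simp
  rw [h]
  ext <;> simp [endEven, endOdd, projZero, projOne]; abel

theorem endEven_mem (z : Module.End F (V₀ × V₁)) : endEven z ∈ endPart F V₀ V₁ 0 := by
  intro j x hx
  rcases parity_cases j with rfl | rfl
  · have hx' := mem_vecPart_zero.1 hx
    exact mem_vecPart_zero.2 (by simp [endEven, projZero, projOne, hx', Prod.mk_zero_zero])
  · have hx' := mem_vecPart_one.1 hx
    exact mem_vecPart_one.2 (by simp [endEven, projZero, projOne, hx', Prod.mk_zero_zero])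

theorem endOdd_mem (z : Module.End F (V₀ × V₁)) : endOdd z ∈ endPart F V₀ V₁ 1 := by
  intro j x hx
  rcases parity_cases j with rfl | rfl
  · have hx' := mem_vecPart_zero.1 hx
    exact mem_vecPart_one.2 (by simp [endOdd, projZero, projOne, hx', Prod.mk_zero_zero])
  · have hx' := mem_vecPart_one.1 hx
    exact mem_vecPart_zero.2 (by simp [endOdd, projZero, projOne, hx', Prod.mk_zero_zero])

theorem endOdd_eq_zero {z : Module.End F (V₀ × V₁)} (hz : z ∈ endPart F V₀ V₁ 0) :
    endOdd z = 0 := by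
  have h0 : ∀ a : V₀, (z (a, 0)).2 = 0 := fun a =>
    mem_vecPart_zero.1 (hz 0 (a, 0) (mem_vecPart_zero.2 rfl))
  have h1 : ∀ b : V₁, (z (0, b)).1 = 0 := fun b =>
    mem_vecPart_one.1 (hz 1 (0, b) (mem_vecPart_one.2 rfl))
  apply LinearMap.ext
  rintro ⟨a, b⟩
  ext <;> simp [endOdd, projZero, projOne, h0, h1]

theorem endEven_eq_zero {z : Module.End F (V₀ × V₁)} (hz : z ∈ endPart F V₀ V₁ 1) :
    endEven z = 0 := by
  have h0 : ∀ a : V₀, (z (a, 0)).1 = 0 := fun a =>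
    mem_vecPart_one.1 (hz 0 (a, 0) (mem_vecPart_zero.2 rfl))
  have h1 : ∀ b : V₁, (z (0, b)).2 = 0 := fun b =>
    mem_vecPart_zero.1 (hz 1 (0, b) (mem_vecPart_one.2 rfl))
  apply LinearMap.ext
  rintro ⟨a, b⟩
  ext <;> simp [endEven, projZero, projOne, h0, h1]

variable (F V₀ V₁) in
/-- The supercommutator on `End(V₀ ⊕ V₁)`: the bilinear extension of
`[X, Y] = XY - (-1)^{ij} YX` for `X` of parity `i` and `Y` of parity `j`. -/
def superComm : Module.End F (V₀ × V₁) →ₗ[F] Module.End F (V₀ × V₁) →ₗ[F]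
    Module.End F (V₀ × V₁) :=
  LinearMap.mk₂ F (fun X Y => X * Y - (endEven Y * X + endOdd Y * (endEven X - endOdd X)))
    (by
      intros
      simp only [endEven, endOdd, mul_add, add_mul, mul_sub]
      abel)
    (by
      intros
      simp only [endEven, endOdd, smul_mul_assoc, mul_smul_comm, ← smul_add, ← smul_sub])
    (by
      intros
      simp only [endEven, endOdd, mul_add, add_mul, mul_sub]
      abel)
    (by
      intros
      simp only [endEven, endOdd, smul_mul_assoc, mul_smul_comm, ← smul_add, ← smul_sub])

theorem superComm_apply {i j : ZMod 2} {X Y : Module.End F (V₀ × V₁)}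
    (hX : X ∈ endPart F V₀ V₁ i) (hY : Y ∈ endPart F V₀ V₁ j) :
    superComm F V₀ V₁ X Y = X * Y - superSign F i j • (Y * X) := by
  have key : superComm F V₀ V₁ X Y =
    X * Y - (endEven Y * X + endOdd Y * (endEven X - endOdd X)) := rfl
  have eX := endEven_add_endOdd X
  have eY := endEven_add_endOdd Y
  rw [key]
  rcases parity_cases i with rfl | rfl <;> rcases parity_cases j with rfl | rfl
  · have h1 := endOdd_eq_zero hX
    have h2 := endOdd_eq_zero hY
    rw [h1, add_zero] at eX
    rw [h2, add_zero] at eY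
    rw [h1, h2, eX, eY]
    simp [superSign_zero_left]
  · have h1 := endOdd_eq_zero hX
    have h2 := endEven_eq_zero hY
    rw [h1, add_zero] at eX
    rw [h2, zero_add] at eY
    rw [h1, h2, eX, eY]
    simp [superSign_zero_left]
  · have h1 := endEven_eq_zero hX
    have h2 := endOdd_eq_zero hY
    rw [h1, zero_add] at eX
    rw [h2, add_zero] at eY
    rw [h1, h2, eX, eY]
    simp [superSign_zero_right]
  · have h1 := endEven_eq_zero hX
    have h2 := endEven_eq_zero hY
    rw [h1, zero_add] at eX
    rw [h2, zero_add] at eY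
    rw [h1, h2, eX, eY]
    rw [superSign_one_one, zero_mul, zero_add, zero_sub]
    exact congrArg (X * Y - ·) ((mul_neg Y X).trans (neg_one_smul F (Y * X)).symm)

theorem mul_mem_endPart {i j : ZMod 2} {X Y : Module.End F (V₀ × V₁)}
    (hX : X ∈ endPart F V₀ V₁ i) (hY : Y ∈ endPart F V₀ V₁ j) :
    X * Y ∈ endPart F V₀ V₁ (i + j) := by
  intro k x hx
  rw [add_assoc]
  exact hX _ _ (hY _ _ hx)

theorem superComm_mem {i j : ZMod 2} {X Y : Module.End F (V₀ × V₁)}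
    (hX : X ∈ endPart F V₀ V₁ i) (hY : Y ∈ endPart F V₀ V₁ j) :
    superComm F V₀ V₁ X Y ∈ endPart F V₀ V₁ (i + j) := by
  rw [superComm_apply hX hY]
  refine sub_mem (mul_mem_endPart hX hY) (Submodule.smul_mem _ _ ?_)
  rw [add_comm]
  exact mul_mem_endPart hY hX

/-- The Lie superalgebra `𝔤𝔩(V₀|V₁)`. -/
instance glSuperalgebra : LieSuperalgebra F (Module.End F (V₀ × V₁)) where
  part := endPart F V₀ V₁
  bracket := superComm F V₀ V₁
  isCompl := by
    constructor
    · rw [Submodule.disjoint_def]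
      intro x h0 h1
      rw [← endEven_add_endOdd x, endOdd_eq_zero h0, endEven_eq_zero h1, add_zero]
    · rw [codisjoint_iff, eq_top_iff]
      intro x _
      exact Submodule.mem_sup.2 ⟨_, endEven_mem x, _, endOdd_mem x, endEven_add_endOdd x⟩
  bracket_mem hx hy := superComm_mem hx hy
  skew := by
    intro i j x y hx hy
    rw [superComm_apply hx hy, superComm_apply hy hx]
    exact assoc_super_skew (F := F) i j x y
  jacobi := by
    intro i j x y hx hy z
    have key : ∀ (k : ZMod 2) (z : Module.End F (V₀ × V₁)), z ∈ endPart F V₀ V₁ k →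
        superComm F V₀ V₁ x (superComm F V₀ V₁ y z) =
          superComm F V₀ V₁ (superComm F V₀ V₁ x y) z +
            superSign F i j • superComm F V₀ V₁ y (superComm F V₀ V₁ x z) := by
      intro k z hz
      rw [superComm_apply hx (superComm_mem hy hz), superComm_apply (superComm_mem hx hy) hz,
        superComm_apply hy (superComm_mem hx hz), superComm_apply hy hz, superComm_apply hx hy,
        superComm_apply hx hz]
      exact assoc_super_jacobi (F := F) i j k x y z
    have h0 := key 0 _ (endEven_mem z)
    have h1 := key 1 _ (endOdd_mem z)
    rw [← endEven_add_endOdd z]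
    simp only [map_add, h0, h1, smul_add]
    abel

/-! ### The orthosymplectic Lie superalgebra -/

/-- A non-degenerate even supersymmetric bilinear form on `V = V₀ ⊕ V₁`: the subspaces `V₀` and
`V₁` are orthogonal, the form is symmetric on `V₀` and skew-symmetric on `V₁`. -/
structure IsOrthosymplecticForm (φ : LinearMap.BilinForm F (V₀ × V₁)) : Prop where
  nondegenerate : φ.Nondegenerate
  even_odd : ∀ (x : V₀) (y : V₁), φ (x, 0) (0, y) = 0
  odd_even : ∀ (x : V₁) (y : V₀), φ (0, x) (y, 0) = 0
  symm_even : ∀ x y : V₀, φ (x, 0) (y, 0) = φ (y, 0) (x, 0)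
  skew_odd : ∀ x y : V₁, φ (0, x) (0, y) = -φ (0, y) (0, x)

/-- The space `𝔬𝔰𝔭(V, φ)_i` of all `z ∈ 𝔤𝔩(V)_i` with `φ(z x, y) = -(-1)^{ij} φ(x, z y)` for all
`x ∈ V_j` and all `y ∈ V`. -/
def ospPart (φ : LinearMap.BilinForm F (V₀ × V₁)) (i : ZMod 2) :
    Submodule F (Module.End F (V₀ × V₁)) where
  carrier := {z | z ∈ endPart F V₀ V₁ i ∧
    ∀ j, ∀ x ∈ vecPart F V₀ V₁ j, ∀ y, φ (z x) y = -(superSign F i j * φ x (z y))}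
  add_mem' := by
    rintro a b ⟨ha, ha'⟩ ⟨hb, hb'⟩
    refine ⟨add_mem ha hb, fun j x hx y => ?_⟩
    simp only [LinearMap.add_apply, map_add, ha' j x hx y, hb' j x hx y]
    ring
  zero_mem' := ⟨Submodule.zero_mem _, by simp⟩
  smul_mem' := by
    rintro c a ⟨ha, ha'⟩
    refine ⟨Submodule.smul_mem _ c ha, fun j x hx y => ?_⟩
    simp only [LinearMap.smul_apply, map_smul, ha' j x hx y, smul_eq_mul]
    ring

theorem superComm_mem_ospPart {φ : LinearMap.BilinForm F (V₀ × V₁)} {i j : ZMod 2}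
    {X Y : Module.End F (V₀ × V₁)} (hX : X ∈ ospPart φ i) (hY : Y ∈ ospPart φ j) :
    superComm F V₀ V₁ X Y ∈ ospPart φ (i + j) := by
  refine ⟨superComm_mem hX.1 hY.1, fun k x hx y => ?_⟩
  rw [superComm_apply hX.1 hY.1]
  simp only [LinearMap.sub_apply, LinearMap.smul_apply, Module.End.mul_apply, map_sub, map_smul,
    smul_eq_mul]
  rw [hX.2 _ _ (hY.1 _ _ hx), hY.2 _ _ hx, hY.2 _ _ (hX.1 _ _ hx), hX.2 _ _ hx]
  rcases parity_cases i with rfl | rfl <;> rcases parity_cases j with rfl | rfl <;>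
    rcases parity_cases k with rfl | rfl <;>
    simp [superSign_zero_left, superSign_zero_right, superSign_one_one,
      show (1 : ZMod 2) + 1 = 0 from rfl] <;> ring

/-- The orthosymplectic Lie superalgebra `𝔬𝔰𝔭(V, φ) = 𝔬𝔰𝔭(V, φ)₀ ⊕ 𝔬𝔰𝔭(V, φ)₁`, as a
sub-superalgebra of `𝔤𝔩(V₀|V₁)`. -/
def osp (φ : LinearMap.BilinForm F (V₀ × V₁)) :
    LieSubsuperalgebra F (Module.End F (V₀ × V₁)) where
  toSubmodule := ospPart φ 0 ⊔ ospPart φ 1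
  bracket_mem' := by
    intro x y hx hy
    obtain ⟨a, ha, b, hb, rfl⟩ := Submodule.mem_sup.1 hx
    obtain ⟨c, hc, d, hd, rfl⟩ := Submodule.mem_sup.1 hy
    have hac : superComm F V₀ V₁ a c ∈ ospPart φ 0 := by
      simpa only [add_zero] using superComm_mem_ospPart ha hc
    have hbd : superComm F V₀ V₁ b d ∈ ospPart φ 0 := by
      have h := superComm_mem_ospPart hb hd
      rwa [show (1 : ZMod 2) + 1 = 0 from rfl] at h
    have had : superComm F V₀ V₁ a d ∈ ospPart φ 1 := by
      simpa only [zero_add] using superComm_mem_ospPart ha hd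
    have hbc : superComm F V₀ V₁ b c ∈ ospPart φ 1 := by
      simpa only [add_zero] using superComm_mem_ospPart hb hc
    change superComm F V₀ V₁ (a + b) (c + d) ∈ _
    rw [LinearMap.map_add₂, map_add, map_add]
    exact add_mem
      (add_mem (Submodule.mem_sup_left hac) (Submodule.mem_sup_right had))
      (add_mem (Submodule.mem_sup_right hbc) (Submodule.mem_sup_left hbd))
  graded' := by
    intro x hx
    obtain ⟨a, ha, b, hb, rfl⟩ := Submodule.mem_sup.1 hx
    exact ⟨a, b, Submodule.mem_sup_left ha, Submodule.mem_sup_right hb, ha.1, hb.1, rfl⟩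

/-- The endomorphism of `V₀` induced by an endomorphism of `V₀ ⊕ V₁` (for an even endomorphism,
its restriction). -/
def blockZero (z : Module.End F (V₀ × V₁)) : Module.End F V₀ :=
  LinearMap.fst F V₀ V₁ ∘ₗ z ∘ₗ LinearMap.inl F V₀ V₁

/-- The endomorphism of `V₁` induced by an endomorphism of `V₀ ⊕ V₁` (for an even endomorphism,
its restriction). -/
def blockOne (z : Module.End F (V₀ × V₁)) : Module.End F V₁ :=
  LinearMap.snd F V₀ V₁ ∘ₗ z ∘ₗ LinearMap.inr F V₀ V₁

end GeneralLinear

/-- The standard non-degenerate supersymmetric form on `F^m ⊕ F^{2n}`: the dot product on `F^m`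
and the standard symplectic form on `F^{2n}`. -/
def stdForm (F : Type*) [Field F] (m n : ℕ) :
    LinearMap.BilinForm F ((Fin m → F) × (Fin n ⊕ Fin n → F)) :=
  LinearMap.mk₂ F (fun x y => ∑ i, x.1 i * y.1 i +
      ∑ i, (x.2 (Sum.inl i) * y.2 (Sum.inr i) - x.2 (Sum.inr i) * y.2 (Sum.inl i)))
    (by
      intros
      simp only [Prod.fst_add, Prod.snd_add, Pi.add_apply, add_mul, Finset.sum_add_distrib,
        Finset.sum_sub_distrib]
      ring)
    (by
      intros
      simp only [Prod.smul_fst, Prod.smul_snd, Pi.smul_apply, smul_eq_mul, mul_assoc,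
        ← mul_sub, ← Finset.mul_sum, ← mul_add])
    (by
      intros
      simp only [Prod.fst_add, Prod.snd_add, Pi.add_apply, mul_add, Finset.sum_add_distrib,
        Finset.sum_sub_distrib]
      ring)
    (by
      intros
      simp only [Prod.smul_fst, Prod.smul_snd, Pi.smul_apply, smul_eq_mul, mul_left_comm,
        ← mul_sub, ← Finset.mul_sum, ← mul_add])

/-- The standard orthosymplectic Lie superalgebra `𝔬𝔰𝔭(m|2n)` over `F`. -/
abbrev stdOsp (F : Type*) [Field F] (m n : ℕ) :
    LieSubsuperalgebra F (Module.End F ((Fin m → F) × (Fin n ⊕ Fin n → F))) :=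
  osp (stdForm F m n)

/-! ### Partitions -/

/-- The endomorphism `N` of `V` is nilpotent with Jordan type `p`: there are vectors `v i` such that
the `N^j (v i)` with `j < a i` form a basis of `V` and `N^(a i) (v i) = 0`, where the `a i` are the
parts of `p`. -/
def HasJordanType {F V : Type*} [Field F] [AddCommGroup V] [Module F V] (N : Module.End F V)
    {k : ℕ} (p : k.Partition) : Prop :=
  ∃ (r : ℕ) (a : Fin r → ℕ) (v : Fin r → V),
    Finset.univ.val.map a = p.parts ∧
    (∀ i, (N ^ a i) (v i) = 0) ∧
    LinearIndependent F (fun x : Σ i, Fin (a i) => (N ^ (x.2 : ℕ)) (v x.1)) ∧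
    Submodule.span F (Set.range fun x : Σ i, Fin (a i) => (N ^ (x.2 : ℕ)) (v x.1)) = ⊤

/-- The partition `(p|q)` of `(m|2n)` is orthosymplectic: even parts of `p` and odd parts of `q`
have even multiplicity. -/
structure IsOrthosymplecticPartition {m n : ℕ} (p : m.Partition) (q : (2 * n).Partition) :
    Prop where
  orthogonal : ∀ t ∈ p.parts, Even t → Even (p.parts.count t)
  symplectic : ∀ t ∈ q.parts, Odd t → Even (q.parts.count t)

/-- The set of the distinct odd parts of `p` and `q`. -/
def oddParts {k l : ℕ} (p : k.Partition) (q : l.Partition) : Finset ℕ :=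
  (p.parts.toFinset ∪ q.parts.toFinset).filter Odd

/-- The set of the distinct even parts of `p` and `q`. -/
def evenParts {k l : ℕ} (p : k.Partition) (q : l.Partition) : Finset ℕ :=
  (p.parts.toFinset ∪ q.parts.toFinset).filter Even

/-! By the representation theory of `𝔰𝔩₂`, `V` is the direct sum over `d > 0` of `L(d) ⊗ W_d`, where
`L(d)` is irreducible of dimension `d` and `W_d = lowestSpace h f d` is the space of lowest weight
vectors of weight `1 - d`. An endomorphism commuting with the triple preserves each `W_d`, is
determined by its restrictions there, and any family of endomorphisms of the `W_d` extends along the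
strings `e ^ j w`. It remains to see which families lie in `𝔬𝔰𝔭(V, φ)`.

Invariance of `φ` under `e` and `h` makes the strings orthogonal except in complementary degrees of
the same `d`, so `φ` amounts to the forms `(x, y) ↦ φ(x, e^(d-1) y)` on the `W_d`, each
non-degenerate. Moving `e^(d-1)` across `φ` costs `(-1)^(d-1)`. For odd `d` the symmetry type is
kept, and `W_d` is an orthosymplectic space. For even `d` it is reversed: the form is skew on the
even part and symmetric on the odd part, so `W_d` is orthosymplectic after a change of parity. This
is why the multiplicities in `p` and `q` trade places in the second family of factors. Over an
algebraically closed field such forms are determined by the dimensions, which are the multiplicities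
of `d` in `p` and in `q`.

The decomposition into strings is `EndSl2Triple.stringMap_injective` and
`EndSl2Triple.stringMap_surjective`; the place of Weyl's complete reducibility theorem is taken by
`EndSl2Triple.disjoint_ker_e_range_f`. The dimensions come from `EndSl2Triple.finrank_lowestSpace`,
the comparison of forms from `IsAdapted.extend_mem_ospPart_iff`, and the normal forms on `W_d` from
`exists_chart_of_odd` and `exists_chart_of_even`. -/

open Polynomial

/-! ### Representations of `𝔰𝔩₂` -/

section EndSl2

variable {F U : Type*} [Field F] [AddCommGroup U] [Module F U]

/-- `e, h, f` are endomorphisms that satisfy the relations of an `𝔰𝔩₂`-triple. -/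
structure EndSl2Triple (e h f : Module.End F U) : Prop where
  e_f : ∀ u, f (e u) = e (f u) - h u
  h_e : ∀ u, h (e u) = e (h u) + (2 : F) • e u
  h_f : ∀ u, h (f u) = f (h u) - (2 : F) • f u

/-- The lowest weight vectors of weight `1 - d`, which generate the copies of the
`d`-dimensional irreducible representation. -/
def lowestSpace (h f : Module.End F U) (d : ℕ) : Submodule F U :=
  LinearMap.ker f ⊓ Module.End.eigenspace h (1 - (d : F))

theorem mem_lowestSpace {h f : Module.End F U} {d : ℕ} {u : U} :
    u ∈ lowestSpace h f d ↔ f u = 0 ∧ h u = (1 - (d : F)) • u := by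
  simp [lowestSpace]

namespace EndSl2Triple

variable {e h f : Module.End F U}

/-- The Chevalley involution: it turns each statement about `ker f` and lowest weights into one
about `ker e` and highest weights. -/
theorem symm (t : EndSl2Triple e h f) : EndSl2Triple f (-h) e where
  e_f u := by simp [t.e_f u]
  h_e u := by simp [t.h_f u]; abel
  h_f u := by simp [t.h_e u]; abel

theorem h_pow_e (t : EndSl2Triple e h f) (k : ℕ) (u : U) :
    h ((e ^ k) u) = (e ^ k) (h u) + (2 * k : F) • (e ^ k) u := by
  induction k with
  | zero => simp
  | succ k ih =>
    simp only [pow_succ', Module.End.mul_apply, t.h_e, ih, map_add, map_smul]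
    push_cast
    module

theorem f_pow_e (t : EndSl2Triple e h f) (k : ℕ) (u : U) :
    f ((e ^ (k + 1)) u) = (e ^ (k + 1)) (f u) - (k + 1 : F) • (e ^ k) (h u + (k : F) • u) := by
  induction k with
  | zero => simp [t.e_f]
  | succ k ih =>
    rw [pow_succ' e (k + 1), Module.End.mul_apply, t.e_f, ih, t.h_pow_e]
    simp only [pow_succ', Module.End.mul_apply, map_add, map_smul, map_sub]
    push_cast
    module

theorem f_aeval_h (t : EndSl2Triple e h f) {u : U} (hu : f u = 0) (P : F[X]) :
    f (aeval h P u) = 0 := by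
  induction P using Polynomial.induction_on with
  | C a => simp [Module.algebraMap_end_apply, hu]
  | add p q hp hq => simp [hp, hq]
  | monomial n a hn =>
    have : aeval h (C a * X ^ (n + 1)) u = h (aeval h (C a * X ^ n) u) := by
      rw [← Module.End.mul_apply]
      congr 1
      simp only [map_mul, aeval_C, map_pow, aeval_X]
      rw [pow_succ', ← mul_assoc, ← mul_assoc, (Algebra.commutes a h)]
    rw [this]
    have h1 := t.h_f (aeval h (C a * X ^ n) u)
    rw [hn] at h1
    simpa using h1.symm

/-- On `ker f` the operator `f^k e^k` is, up to a nonzero scalar in characteristic zero, `h (h + 1)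
⋯ (h + k - 1)`. The induction generalizes `u` because it passes from `u` to `(h + k) u`, which is
again in `ker f`. -/
theorem pow_f_pow_e (t : EndSl2Triple e h f) (k : ℕ) {u : U} (hu : f u = 0) :
    (f ^ k) ((e ^ k) u) = ((-1) ^ k * (k.factorial : F)) •
      aeval h (Lagrange.nodal (Finset.range k) fun i : ℕ => -(i : F)) u := by
  induction k generalizing u with
  | zero => simp [Lagrange.nodal]
  | succ k ih =>
    have hX : aeval h (X + C (k : F)) u = h u + (k : F) • u := by
      simp [Nat.cast_smul_eq_nsmul]
    rw [pow_succ, Module.End.mul_apply, t.f_pow_e, hu, map_zero, zero_sub, map_neg, map_smul,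
      ← hX, ih (t.f_aeval_h hu _), ← Module.End.mul_apply, ← map_mul, Lagrange.nodal,
      Lagrange.nodal, Finset.prod_range_succ, Nat.factorial_succ, smul_smul, ← neg_smul]
    simp only [map_neg, sub_neg_eq_add]
    push_cast
    ring_nf

/-- If no power of `e` vanished, the powers would be eigenvectors of `ad h` with the distinct
eigenvalues `2n`: infinitely many independent vectors in the finite-dimensional `End U`. -/
theorem exists_pow_e_eq_zero [CharZero F] [FiniteDimensional F U] (t : EndSl2Triple e h f) :
    ∃ N : ℕ, e ^ N = 0 := by
  by_contra! hN
  let A : Module.End F (Module.End F U) := LinearMap.mulLeft F h - LinearMap.mulRight F h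
  have hinj : Function.Injective fun n : ℕ => (2 * n : F) := by
    intro a b hab
    simpa using hab
  have := Module.End.eigenvectors_linearIndependent' A (fun n : ℕ => (2 * n : F)) hinj
    (fun n => e ^ n) (fun n => ⟨by
      rw [Module.End.mem_eigenspace_iff]
      ext u
      simp [A, t.h_pow_e], hN n⟩)
  have := this.finite
  exact _root_.not_finite ℕ

theorem exists_pow_f_eq_zero [CharZero F] [FiniteDimensional F U] (t : EndSl2Triple e h f) :
    ∃ N : ℕ, f ^ N = 0 := t.symm.exists_pow_e_eq_zero

/-- Since `f` is nilpotent, `f^N e^N = 0`, and `pow_f_pow_e` gives a polynomial with simple roots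
`0, -1, -2, …` that kills `h` on `ker f`. So `h` is diagonalizable there, with eigenvalues in `-ℕ`.
-/
theorem exists_nodal_annihilates [CharZero F] [FiniteDimensional F U] (t : EndSl2Triple e h f) :
    ∃ N : ℕ, ∀ u, f u = 0 →
      aeval h (Lagrange.nodal (Finset.range N) fun i : ℕ => -(i : F)) u = 0 := by
  obtain ⟨N, hN⟩ := t.exists_pow_f_eq_zero
  refine ⟨N, fun u hu => ?_⟩
  have h1 := t.pow_f_pow_e N hu
  rw [hN, LinearMap.zero_apply, eq_comm, smul_eq_zero] at h1
  refine h1.resolve_left (mul_ne_zero (pow_ne_zero _ (by simp)) ?_)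
  exact_mod_cast N.factorial_ne_zero

theorem exists_eq_neg_natCast_of_eigenvector [CharZero F] [FiniteDimensional F U]
    (t : EndSl2Triple e h f) {u : U}
    {μ : F} (hf : f u = 0) (hh : h u = μ • u) (hu : u ≠ 0) : ∃ k : ℕ, μ = -(k : F) := by
  obtain ⟨N, hN⟩ := t.exists_nodal_annihilates
  have h1 := hN u hf
  rw [Module.End.aeval_apply_of_mem_apply_eq_smul hh, smul_eq_zero, Lagrange.eval_nodal,
    Finset.prod_eq_zero_iff] at h1
  obtain ⟨k, -, hk⟩ := h1.resolve_right hu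
  exact ⟨k, sub_eq_zero.1 hk⟩

/-- The kernel of `f` is spanned by the lowest weight vectors. -/
theorem ker_f_le_iSup_lowestSpace [CharZero F] [FiniteDimensional F U] (t : EndSl2Triple e h f) :
    LinearMap.ker f ≤ ⨆ d : ℕ, lowestSpace h f (d + 1) := by
  intro u hu
  rw [LinearMap.mem_ker] at hu
  obtain ⟨N, hN⟩ := t.exists_nodal_annihilates
  have hinj : Set.InjOn (fun i : ℕ => -(i : F)) (Finset.range N) := by
    intro a _ b _ hab
    simpa using hab
  rcases Nat.eq_zero_or_pos N with rfl | hpos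
  · have := hN u hu
    simp [Lagrange.nodal] at this
    rw [this]; exact zero_mem _
  have hsum := Lagrange.sum_basis hinj ⟨0, by simpa using hpos⟩
  -- The Lagrange basis polynomials evaluated at `h` are the projections onto the eigenspaces. The
  -- eigenvalue `-i` is `1 - (i + 1)`, so the `i`-th component lies in `lowestSpace h f (i + 1)`.
  have hu' : u = ∑ i ∈ Finset.range N,
      aeval h (Lagrange.basis (Finset.range N) (fun i : ℕ => -(i : F)) i) u := by
    rw [← LinearMap.sum_apply, ← map_sum, hsum]
    simp
  rw [hu']
  refine sum_mem fun i hi => Submodule.mem_iSup_of_mem i (mem_lowestSpace.2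
    ⟨t.f_aeval_h hu _, ?_⟩)
  have key : (X - C (-(i : F))) * Lagrange.basis (Finset.range N) (fun i : ℕ => -(i : F)) i =
      C (Lagrange.nodalWeight (Finset.range N) (fun i : ℕ => -(i : F)) i) *
        Lagrange.nodal (Finset.range N) fun i : ℕ => -(i : F) := by
    rw [Lagrange.basis_eq_prod_sub_inv_mul_nodal_div hi, ← Lagrange.nodal_erase_eq_nodal_div hi,
      Lagrange.nodal_eq_mul_nodal_erase hi]
    ring
  have h2 : aeval h ((X - C (-(i : F))) *
      Lagrange.basis (Finset.range N) (fun i : ℕ => -(i : F)) i) u = 0 := by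
    rw [key, map_mul, Module.End.mul_apply, hN u hu, map_zero]
  rw [map_mul, Module.End.mul_apply] at h2
  simp only [map_neg, sub_neg_eq_add, map_add, aeval_X, aeval_C, LinearMap.add_apply,
    Module.algebraMap_end_apply] at h2
  rw [eq_neg_of_add_eq_zero_left h2]
  push_cast
  module

/-- Otherwise `e^d u` would be a nonzero vector killed by `f` of weight `(1 - d) + 2d = d + 1 > 0`,
whereas the weights on `ker f` are at most `0`. -/
theorem pow_e_lowest [CharZero F] [FiniteDimensional F U] (t : EndSl2Triple e h f) {d : ℕ} {u : U}
    (hu : u ∈ lowestSpace h f d) (hd : 0 < d) : (e ^ d) u = 0 := by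
  obtain ⟨d, rfl⟩ : ∃ k, d = k + 1 := ⟨d - 1, by omega⟩
  obtain ⟨hf, hh⟩ := mem_lowestSpace.1 hu
  by_contra hne
  have h1 : f ((e ^ (d + 1)) u) = 0 := by
    rw [t.f_pow_e, hf, hh]
    push_cast
    simp only [← add_smul]
    simp
  have h2 : h ((e ^ (d + 1)) u) = ((d + 2 : ℕ) : F) • (e ^ (d + 1)) u := by
    rw [t.h_pow_e, hh, map_smul, ← add_smul]
    push_cast
    ring_nf
  obtain ⟨k, hk⟩ := t.exists_eq_neg_natCast_of_eigenvector h1 h2 hne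
  rw [eq_neg_iff_add_eq_zero] at hk
  norm_cast at hk
  omega

theorem pow_e_lowest_of_le [CharZero F] [FiniteDimensional F U]
    (t : EndSl2Triple e h f) {d j : ℕ} {u : U}
    (hu : u ∈ lowestSpace h f d) (hd : 0 < d) (hj : d ≤ j) : (e ^ j) u = 0 := by
  obtain ⟨k, rfl⟩ := Nat.exists_eq_add_of_le' hj
  rw [pow_add, Module.End.mul_apply, t.pow_e_lowest hu hd, map_zero]

theorem f_pow_e_lowest (t : EndSl2Triple e h f) {d : ℕ} {u : U}
    (hu : u ∈ lowestSpace h f d) (j : ℕ) :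
    f ((e ^ (j + 1)) u) = ((j + 1 : F) * (d - (j + 1))) • (e ^ j) u := by
  obtain ⟨hf, hh⟩ := mem_lowestSpace.1 hu
  rw [t.f_pow_e, hf, hh, map_zero, ← add_smul, map_smul]
  module

/-- The scalar by which `f ^ j * e ^ j` acts on the lowest weight vectors of weight `1 - d`. -/
theorem exists_pow_f_pow_e_lowest [CharZero F] (t : EndSl2Triple e h f) {d j : ℕ} (hj : j < d) :
    ∃ c : F, c ≠ 0 ∧ ∀ u ∈ lowestSpace h f d, (f ^ j) ((e ^ j) u) = c • u := by
  induction j with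
  | zero => exact ⟨1, one_ne_zero, by simp⟩
  | succ j ih =>
    obtain ⟨c, hc, hcu⟩ := ih (by omega)
    refine ⟨(j + 1 : F) * (d - (j + 1)) * c, mul_ne_zero (mul_ne_zero ?_ ?_) hc, fun u hu => ?_⟩
    · exact_mod_cast j.succ_ne_zero
    · rw [sub_ne_zero]
      exact_mod_cast hj.ne'
    · rw [pow_succ, Module.End.mul_apply, t.f_pow_e_lowest hu, map_smul, hcu u hu, smul_smul]

theorem pow_f_pow_e_lowest_eq_zero (t : EndSl2Triple e h f) {d j k : ℕ} (hjk : j < k) {u : U}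
    (hu : u ∈ lowestSpace h f d) : (f ^ k) ((e ^ j) u) = 0 := by
  induction j generalizing k with
  | zero =>
    obtain ⟨k, rfl⟩ : ∃ k', k = k' + 1 := ⟨k - 1, by omega⟩
    simp [pow_succ, (mem_lowestSpace.1 hu).1]
  | succ j ih =>
    obtain ⟨k, rfl⟩ : ∃ k', k = k' + 1 := ⟨k - 1, by omega⟩
    rw [pow_succ, Module.End.mul_apply, t.f_pow_e_lowest hu, map_smul, ih (by omega), smul_zero]

/-- Because `e (f x) = 0`, the vector `x` behaves under `f e^(n+1)` like a lowest weight vector, but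
of positive weight. The scalars `-(n+1)(k+2+n)` never vanish, so a nonzero `x` would generate an
infinite string, against nilpotency of `e`. -/
theorem eq_zero_of_e_f_eq_zero [CharZero F] [FiniteDimensional F U]
    (t : EndSl2Triple e h f) {x : U} {k : ℕ}
    (hx : e (f x) = 0) (hh : h x = (k + 2 : F) • x) : x = 0 := by
  have key : ∀ n : ℕ, ∃ c : F, c ≠ 0 ∧ f ((e ^ (n + 1)) x) = c • (e ^ n) x := by
    intro n
    refine ⟨-((n + 1 : F) * (k + 2 + n)), neg_ne_zero.2 (mul_ne_zero ?_ ?_), ?_⟩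
    · exact_mod_cast n.succ_ne_zero
    · norm_cast
      omega
    · rw [t.f_pow_e, hh, pow_succ, Module.End.mul_apply, hx, map_zero, ← add_smul, map_smul]
      module
  obtain ⟨N, hN⟩ := t.exists_pow_e_eq_zero
  have : ∀ n, (e ^ n) x = 0 → x = 0 := by
    intro n
    induction n with
    | zero => simp
    | succ n ih =>
      intro hn
      obtain ⟨c, hc, hcx⟩ := key n
      rw [hn, map_zero, eq_comm, smul_eq_zero] at hcx
      exact ih (hcx.resolve_left hc)
  exact this N (by simp [hN])

/-- The substitute for complete reducibility. A nonzero intersection is stable under `h` and so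
contains a weight vector `y = f x`; as `e y = 0`, its weight is some `k ≥ 0`. Once `x` is corrected
to have weight `k + 2`, `eq_zero_of_e_f_eq_zero` kills it, and `y` with it. -/
theorem disjoint_ker_e_range_f [CharZero F] [IsAlgClosed F] [FiniteDimensional F U]
    (t : EndSl2Triple e h f) :
    Disjoint (LinearMap.ker e) (LinearMap.range f) := by
  rw [disjoint_iff]
  by_contra hne
  set K := LinearMap.ker e ⊓ LinearMap.range f with hK
  have hinv : ∀ y ∈ K, h y ∈ K := by
    rintro y ⟨hy, x, rfl⟩
    simp only [SetLike.mem_coe, LinearMap.mem_ker] at hy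
    refine ⟨?_, h x - (2 : F) • x, by rw [t.h_f]; simp⟩
    have := t.h_e (f x)
    rw [hy, map_zero, smul_zero, add_zero] at this
    exact this.symm
  have : Nontrivial K := Submodule.nontrivial_iff_ne_bot.2 hne
  obtain ⟨μ, hμ⟩ := Module.End.exists_eigenvalue (h.restrict hinv)
  obtain ⟨⟨y, hyK⟩, hy⟩ := hμ.exists_hasEigenvector
  have hy1 : h y = μ • y := by simpa using congrArg Subtype.val hy.apply_eq_smul
  have hy0 : y ≠ 0 := fun h0 => hy.2 (Subtype.ext h0)
  obtain ⟨hye, x, rfl⟩ := hyK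
  simp only [SetLike.mem_coe, LinearMap.mem_ker] at hye
  obtain ⟨k, hk⟩ := t.symm.exists_eq_neg_natCast_of_eigenvector (μ := -μ) hye
    (by simp [hy1]) hy0
  rw [neg_inj] at hk
  subst hk
  -- Shift `x` by an element of `ker f` to make it a weight vector.
  have hinv' : ∀ z ∈ LinearMap.ker f, (h - algebraMap F _ (k + 2 : F)) z ∈ LinearMap.ker f := by
    intro z hz
    have h1 := t.h_f z
    simp only [LinearMap.mem_ker] at hz ⊢
    rw [hz] at h1
    rw [map_zero, smul_zero, sub_zero] at h1
    simp [hz, Module.algebraMap_end_apply, ← h1]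
  -- The weights on `ker f` are at most `0`, so `k + 2` is not among them; injectivity gives
  -- surjectivity by finite dimension.
  have hinj : Function.Injective ((h - algebraMap F _ (k + 2 : F)).restrict hinv') := by
    rw [← LinearMap.ker_eq_bot, LinearMap.ker_eq_bot']
    rintro ⟨z, hz⟩ h0
    have h1 : h z = (k + 2 : F) • z := by
      have := congrArg Subtype.val h0
      simpa only [LinearMap.restrict_apply, LinearMap.sub_apply, Module.algebraMap_end_apply,
        sub_eq_zero, ZeroMemClass.coe_zero] using this
    by_contra hz0
    obtain ⟨l, hl⟩ := t.exists_eq_neg_natCast_of_eigenvector hz h1 (fun h => hz0 (Subtype.ext h))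
    rw [eq_neg_iff_add_eq_zero] at hl
    norm_cast at hl
    omega
  have hx' : (h - algebraMap F _ (k + 2 : F)) x ∈ LinearMap.ker f := by
    have h1 := t.h_f x
    rw [hy1] at h1
    simp only [LinearMap.mem_ker, LinearMap.sub_apply, Module.algebraMap_end_apply, map_sub,
      map_smul]
    rw [← sub_eq_zero] at h1
    rw [← neg_eq_zero, ← h1]
    module
  obtain ⟨⟨z, hz⟩, hzx⟩ := LinearMap.injective_iff_surjective.1 hinj ⟨_, hx'⟩
  have hzx' : (h - algebraMap F _ (k + 2 : F)) z = (h - algebraMap F _ (k + 2 : F)) x :=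
    congrArg Subtype.val hzx
  rw [LinearMap.mem_ker] at hz
  have : x - z = 0 := by
    refine t.eq_zero_of_e_f_eq_zero (k := k) (by simp [hz, hye]) ?_
    have : (h - algebraMap F _ (k + 2 : F)) (x - z) = 0 := by rw [map_sub, hzx', sub_self]
    simpa only [LinearMap.sub_apply, Module.algebraMap_end_apply, sub_eq_zero] using this
  apply hy0
  rw [sub_eq_zero.1 this, hz]

end EndSl2Triple

/-- The map `(x i j) ↦ ∑ e ^ j (ι i (x i j))` from a sum of copies of spaces `X i` of lowest weight
vectors. -/
def stringMap {I : Type*} [Fintype I] {X : I → Type*} [∀ i, AddCommGroup (X i)]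
    [∀ i, Module F (X i)] (e : Module.End F U) (d : I → ℕ) (ι : ∀ i, X i →ₗ[F] U) :
    (∀ i, Fin (d i) → X i) →ₗ[F] U :=
  ∑ i, ∑ j : Fin (d i), (e ^ (j : ℕ)) ∘ₗ ι i ∘ₗ LinearMap.proj j ∘ₗ LinearMap.proj i

/-! ### Decomposition of a representation into strings -/

section StringMap

variable {I : Type*} [Fintype I] {X : I → Type*} [∀ i, AddCommGroup (X i)]
    [∀ i, Module F (X i)] {e h f : Module.End F U} {d : I → ℕ} {ι : ∀ i, X i →ₗ[F] U}

theorem stringMap_apply (x : ∀ i, Fin (d i) → X i) :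
    stringMap e d ι x = ∑ i, ∑ j : Fin (d i), (e ^ (j : ℕ)) (ι i (x i j)) := by
  simp [stringMap, LinearMap.sum_apply]

theorem stringMap_single [DecidableEq I] (i : I) (j : Fin (d i)) (x : X i) :
    stringMap e d ι (Pi.single i (Pi.single j x)) = (e ^ (j : ℕ)) (ι i x) := by
  rw [stringMap_apply, Finset.sum_eq_single i, Finset.sum_eq_single j]
  · simp
  · intro k _ hk; simp [Pi.single_eq_of_ne hk]
  · simp
  · intro k _ hk; simp [Pi.single_eq_of_ne hk]
  · simp

/-- Apply `f^j` to a relation. Terms `e^l w` with `l < j` die, those with `l > j` are already known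
to be zero, and those with `l = j` return as nonzero multiples of lowest weight vectors, which for
different `i` lie in different eigenspaces of `h`. -/
theorem EndSl2Triple.stringMap_injective [CharZero F] (t : EndSl2Triple e h f)
    (hd : Function.Injective d)
    (hι : ∀ i, Function.Injective (ι i)) (hW : ∀ i, LinearMap.range (ι i) = lowestSpace h f (d i)) :
    Function.Injective (stringMap e d ι) := by
  have hmem : ∀ i x, ι i x ∈ lowestSpace h f (d i) := fun i x => hW i ▸ LinearMap.mem_range_self _ x
  rw [← LinearMap.ker_eq_bot, LinearMap.ker_eq_bot']
  intro x hx
  rw [stringMap_apply] at hx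
  set M := ∑ i, d i with hM
  -- Downward induction on `j`: `M` bounds every `d i`, so the case `n = 0` is vacuous.
  have key : ∀ n : ℕ, ∀ i (j : Fin (d i)), M ≤ j + n → x i j = 0 := by
    intro n
    induction n with
    | zero =>
      intro i j hj
      have : d i ≤ M := Finset.single_le_sum (fun _ _ => Nat.zero_le _) (Finset.mem_univ i)
      omega
    | succ n ih =>
      intro i j hj
      have hsum : ∑ k, (f ^ (j : ℕ)) (∑ l : Fin (d k), (e ^ (l : ℕ)) (ι k (x k l))) = 0 := by
        rw [← map_sum, hx, map_zero]
      have hterm : ∀ k, ∀ l : Fin (d k), (l : ℕ) ≠ j →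
          (f ^ (j : ℕ)) ((e ^ (l : ℕ)) (ι k (x k l))) = 0 := by
        intro k l hl
        rcases lt_or_gt_of_ne hl with hl | hl
        · exact t.pow_f_pow_e_lowest_eq_zero hl (hmem _ _)
        · rw [ih k l (by omega)]; simp
      have heig : ∀ k, (f ^ (j : ℕ)) (∑ l : Fin (d k), (e ^ (l : ℕ)) (ι k (x k l))) ∈
          Module.End.eigenspace h (1 - (d k : F)) := by
        intro k
        rw [map_sum]
        refine sum_mem fun l _ => ?_
        by_cases hl : (l : ℕ) = j
        · obtain ⟨c, -, hc⟩ := t.exists_pow_f_pow_e_lowest (d := d k) (j := j) (hl ▸ l.2)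
          rw [hl, hc _ (hmem _ _)]
          exact Submodule.smul_mem _ _ (hmem k _).2
        · rw [hterm k l hl]; exact zero_mem _
      have hinj : Function.Injective fun k => 1 - (d k : F) := by
        intro a b hab
        have : (d a : F) = d b := by simpa using hab
        exact hd (by exact_mod_cast this)
      have hind := (Module.End.eigenspaces_iSupIndep h).comp hinj
      have hzero : (f ^ (j : ℕ)) (∑ l : Fin (d i), (e ^ (l : ℕ)) (ι i (x i l))) = 0 := by
        classical
        refine Submodule.disjoint_def.1 (hind i) _ (heig i) ?_
        rw [← Finset.add_sum_erase _ _ (Finset.mem_univ i)] at hsum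
        rw [eq_neg_of_add_eq_zero_left hsum]
        refine neg_mem (sum_mem fun k hk => ?_)
        exact Submodule.mem_iSup_of_mem k
          (Submodule.mem_iSup_of_mem (Finset.ne_of_mem_erase hk) (heig k))
      rw [map_sum, Finset.sum_eq_single j] at hzero
      · obtain ⟨c, hc, hcu⟩ := t.exists_pow_f_pow_e_lowest (d := d i) j.2
        rw [hcu _ (hmem _ _), smul_eq_zero] at hzero
        exact hι i (by simpa using hzero.resolve_left hc)
      · intro l _ hl
        exact hterm i l (fun h => hl (Fin.ext h))
      · simp
  funext i j
  exact key M i j (by omega)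

/-- The range `S` contains `ker f`, and `S ≤ f(S) + ker e`. If `f u ∈ S`, write `f u = f s + y` with
`e y = 0`; then `y` lies in `ker e ∩ range f = 0`, so `u - s ∈ ker f ≤ S`. Nilpotency of `f` reaches
every `u`. -/
theorem EndSl2Triple.stringMap_surjective [CharZero F] [IsAlgClosed F]
    [FiniteDimensional F U] (t : EndSl2Triple e h f)
    (hpos : ∀ i, 0 < d i) (hW : ∀ i, LinearMap.range (ι i) = lowestSpace h f (d i))
    (hbot : ∀ k, 0 < k → k ∉ Set.range d → lowestSpace h f k = ⊥) :
    Function.Surjective (stringMap e d ι) := by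
  classical
  have hmem : ∀ i x, ι i x ∈ lowestSpace h f (d i) := fun i x => hW i ▸ LinearMap.mem_range_self _ x
  set S := LinearMap.range (stringMap e d ι) with hS
  have hpow : ∀ i x j, (e ^ j) (ι i x) ∈ S := by
    intro i x j
    by_cases hj : j < d i
    · exact ⟨_, stringMap_single i ⟨j, hj⟩ x⟩
    · rw [t.pow_e_lowest_of_le (hmem i x) (hpos i) (by omega)]
      exact zero_mem _
  have hker : LinearMap.ker f ≤ S := by
    refine t.ker_f_le_iSup_lowestSpace.trans (iSup_le fun k => ?_)
    by_cases hk : k + 1 ∈ Set.range d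
    · obtain ⟨i, hi⟩ := hk
      rw [← hi, ← hW i]
      rintro _ ⟨x, rfl⟩
      simpa using hpow i x 0
    · rw [hbot _ k.succ_pos hk]
      exact bot_le
  -- Below the top of its string, `e^j w` is a multiple of `f (e^(j+1) w)`; at the top, `j + 1 = d`,
  -- it is killed by `e`.
  have hdec : S ≤ S.map f ⊔ LinearMap.ker e := by
    rintro _ ⟨x, rfl⟩
    rw [stringMap_apply]
    refine sum_mem fun i _ => sum_mem fun j _ => ?_
    by_cases hj : (j : ℕ) + 1 < d i
    · refine Submodule.mem_sup_left ?_
      have h1 := t.f_pow_e_lowest (hmem i (x i j)) j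
      have hc : ((j : ℕ) + 1 : F) * (d i - ((j : ℕ) + 1)) ≠ 0 := by
        refine mul_ne_zero (by exact_mod_cast (j : ℕ).succ_ne_zero) (sub_ne_zero.2 ?_)
        exact_mod_cast hj.ne'
      rw [← inv_smul_smul₀ hc ((e ^ (j : ℕ)) (ι i (x i j))), ← h1]
      exact Submodule.smul_mem _ _ (Submodule.mem_map_of_mem (hpow _ _ _))
    · refine Submodule.mem_sup_right ?_
      rw [LinearMap.mem_ker, ← Module.End.mul_apply, ← pow_succ']
      exact t.pow_e_lowest_of_le (hmem _ _) (hpos i) (by omega)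
  have hall : ∀ k u, (f ^ k) u = 0 → u ∈ S := by
    intro k
    induction k with
    | zero => intro u hu; simp at hu; rw [hu]; exact zero_mem _
    | succ k ih =>
      intro u hu
      obtain ⟨_, ⟨s, hs, rfl⟩, y, hy, hsy⟩ := Submodule.mem_sup.1
        (hdec (ih (f u) (by rwa [pow_succ, Module.End.mul_apply] at hu)))
      have hy' : y = f (u - s) := by rw [map_sub, ← hsy]; abel
      have hy0 : y = 0 := Submodule.disjoint_def.1 t.disjoint_ker_e_range_f y hy
        (hy' ▸ LinearMap.mem_range_self _ _)
      rw [← sub_add_cancel u s]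
      exact add_mem (hker (by rw [LinearMap.mem_ker, ← hy', hy0])) hs
  obtain ⟨N, hN⟩ := t.exists_pow_f_eq_zero
  intro u
  exact hall N u (by simp [hN])

end StringMap

end EndSl2

/-! ### Jordan types -/

section Jordan

variable {F U : Type*} [Field F] [AddCommGroup U] [Module F U]

/-- `N^k` shifts each Jordan chain by `k`, so the basis vectors at positions at least `k` form a
basis of its range; truncated subtraction counts them, also for chains shorter than `k`. -/
theorem finrank_range_pow_of_jordan {κ : Type*} [Fintype κ] (N : Module.End F U) (a : κ → ℕ)
    (v : κ → U) (hz : ∀ i, (N ^ a i) (v i) = 0)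
    (hli : LinearIndependent F fun x : Σ i, Fin (a i) => (N ^ (x.2 : ℕ)) (v x.1))
    (hspan : Submodule.span F (Set.range fun x : Σ i, Fin (a i) => (N ^ (x.2 : ℕ)) (v x.1)) = ⊤)
    (k : ℕ) : Module.finrank F (LinearMap.range (N ^ k)) = ∑ i, (a i - k) := by
  let g : (Σ i, Fin (a i - k)) → Σ i, Fin (a i) := fun x => ⟨x.1, ⟨x.2 + k, by omega⟩⟩
  have hg : Function.Injective g := by
    rintro ⟨i, j⟩ ⟨i', j'⟩ hij
    simp only [g, Sigma.mk.injEq] at hij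
    obtain ⟨rfl, hij⟩ := hij
    simp only [heq_eq_eq, Fin.mk.injEq, add_left_inj] at hij
    rw [Fin.ext hij]
  have hli' := hli.comp g hg
  have hrange : LinearMap.range (N ^ k) = Submodule.span F
      (Set.range ((fun x : Σ i, Fin (a i) => (N ^ (x.2 : ℕ)) (v x.1)) ∘ g)) := by
    rw [← Submodule.map_top, ← hspan, Submodule.map_span]
    apply le_antisymm
    · rw [Submodule.span_le]
      rintro _ ⟨_, ⟨⟨i, j⟩, rfl⟩, rfl⟩
      simp only [← Module.End.mul_apply, ← pow_add]
      by_cases hj : k + j < a i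
      · refine Submodule.subset_span ⟨⟨i, ⟨j, by omega⟩⟩, ?_⟩
        simp [g, add_comm]
      · rw [← Nat.sub_add_cancel (not_lt.1 hj), pow_add, Module.End.mul_apply, hz, map_zero]
        exact zero_mem _
    · refine Submodule.span_mono ?_
      rintro _ ⟨⟨i, j⟩, rfl⟩
      refine ⟨_, ⟨⟨i, ⟨j, by omega⟩⟩, rfl⟩, ?_⟩
      simp only [← Module.End.mul_apply, ← pow_add]
      simp [g, add_comm]
  rw [hrange, finrank_span_eq_card hli']
  simp

/-- The number of parts equal to `d + 1` is the second difference of the ranks `∑ (a i - k)`. Thus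
the ranks of the powers determine the Jordan type. -/
theorem card_eq_add_two_mul_sum_sub {κ : Type*} [Fintype κ] (a : κ → ℕ) (d : ℕ) :
    (Finset.univ.filter fun i => a i = d + 1).card + 2 * ∑ i, (a i - (d + 1)) =
      ∑ i, (a i - d) + ∑ i, (a i - (d + 2)) := by
  rw [Finset.card_filter, Finset.mul_sum, ← Finset.sum_add_distrib, ← Finset.sum_add_distrib]
  refine Finset.sum_congr rfl fun i _ => ?_
  split_ifs <;> omega

theorem EndSl2Triple.exists_lowestSpace_eq_bot [CharZero F] [FiniteDimensional F U]
    {e h f : Module.End F U} (t : EndSl2Triple e h f) :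
    ∃ M : ℕ, ∀ k, M < k → lowestSpace h f k = ⊥ := by
  obtain ⟨N, hN⟩ := t.exists_pow_e_eq_zero
  refine ⟨N, fun k hk => (Submodule.eq_bot_iff _).2 fun u hu => ?_⟩
  obtain ⟨c, hc, hcu⟩ := t.exists_pow_f_pow_e_lowest hk
  have := hcu u hu
  rw [hN, LinearMap.zero_apply, map_zero, eq_comm, smul_eq_zero] at this
  exact this.resolve_left hc

/-- The strings `e ^ j w` generated by the lowest weight vectors `w` span the representation. -/
theorem EndSl2Triple.eq_zero_of_forall_lowest [CharZero F] [IsAlgClosed F] [FiniteDimensional F U]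
    {e h f : Module.End F U} (t : EndSl2Triple e h f) {g : U →ₗ[F] F}
    (hg : ∀ d, 0 < d → ∀ w ∈ lowestSpace h f d, ∀ j, g ((e ^ j) w) = 0) : g = 0 := by
  obtain ⟨M, hM⟩ := t.exists_lowestSpace_eq_bot
  have hsurj := t.stringMap_surjective (d := fun i : Fin M => (i : ℕ) + 1)
    (ι := fun i => (lowestSpace h f (i + 1)).subtype) (fun i => Nat.succ_pos _)
    (fun i => by simp) (by
      intro k hk hk'
      refine hM k (not_le.1 fun hkM => hk' ⟨⟨k - 1, by omega⟩, ?_⟩)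
      change k - 1 + 1 = k
      omega)
  apply LinearMap.ext
  intro u
  obtain ⟨x, rfl⟩ := hsurj u
  rw [stringMap_apply, map_sum]
  refine Finset.sum_eq_zero fun i _ => ?_
  rw [map_sum]
  exact Finset.sum_eq_zero fun j _ => hg _ (Nat.succ_pos _) _ (x i j).2 _

/-- The multiplicity of the part `d` in the Jordan type of `e` is the dimension of the space of
lowest weight vectors of weight `1 - d`. -/
theorem EndSl2Triple.finrank_lowestSpace [CharZero F] [IsAlgClosed F] [FiniteDimensional F U]
    {e h f : Module.End F U} (t : EndSl2Triple e h f) {m : ℕ} {p : m.Partition}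
    (hp : HasJordanType e p) {d : ℕ} (hd : 0 < d) :
    Module.finrank F (lowestSpace h f d) = p.parts.count d := by
  classical
  obtain ⟨M, hM⟩ := t.exists_lowestSpace_eq_bot
  -- The lengths `1, …, M + d`: all those up to `M`, beyond which the lowest spaces vanish, and
  -- certainly `d` itself, even if its space is zero.
  let D : Fin (M + d) → ℕ := fun i => i + 1
  let ι : ∀ i, lowestSpace h f (D i) →ₗ[F] U := fun i => (lowestSpace h f (D i)).subtype
  have hDinj : Function.Injective D := fun a b hab => Fin.ext (by simpa [D] using hab)
  have hW : ∀ i, LinearMap.range (ι i) = lowestSpace h f (D i) := fun i => by simp [ι]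
  have hinj := t.stringMap_injective hDinj (fun i => Subtype.val_injective) hW
  have hsurj : Function.Surjective (stringMap e D ι) := t.stringMap_surjective
    (fun i => Nat.succ_pos _) hW (by
    intro k hk hk'
    refine hM k (not_le.1 fun hkM => hk' ⟨⟨k - 1, by omega⟩, ?_⟩)
    change k - 1 + 1 = k
    omega)
  let E := LinearEquiv.ofBijective _ ⟨hinj, hsurj⟩
  let B := (Pi.basis fun i => Pi.basis fun _ : Fin (D i) =>
    Module.finBasis F (lowestSpace h f (D i))).map E
  let κ := Σ i, Fin (Module.finrank F (lowestSpace h f (D i)))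
  let v : κ → U := fun x => Module.finBasis F (lowestSpace h f (D x.1)) x.2
  let g : (Σ x : κ, Fin (D x.1)) →
      (Σ i, Σ _ : Fin (D i), Fin (Module.finrank F (lowestSpace h f (D i)))) :=
    fun x => ⟨x.1.1, x.2, x.1.2⟩
  have hg : Function.Bijective g := by
    constructor
    · rintro ⟨⟨i, l⟩, j⟩ ⟨⟨i', l'⟩, j'⟩ hij
      simp only [g, Sigma.mk.injEq] at hij
      obtain ⟨rfl, hij⟩ := hij
      simp only [heq_eq_eq, Sigma.mk.injEq] at hij
      obtain ⟨rfl, rfl⟩ := hij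
      rfl
    · rintro ⟨i, j, l⟩
      exact ⟨⟨⟨i, l⟩, j⟩, rfl⟩
  have hfam : (fun x : Σ x : κ, Fin (D x.1) => (e ^ (x.2 : ℕ)) (v x.1)) = B ∘ g := by
    funext ⟨⟨i, l⟩, j⟩
    simp only [Function.comp_apply, B, g, Module.Basis.map_apply, Pi.basis_apply]
    exact (stringMap_single (e := e) (d := D) (ι := ι) i j _).symm
  -- The strings form a second Jordan basis for `e`. It gives the same ranks of `e^k` as the basis
  -- provided by `hp`, hence the same multiplicities.
  have hrank := finrank_range_pow_of_jordan e (fun x : κ => D x.1) v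
    (fun x => t.pow_e_lowest (Subtype.coe_prop _) (Nat.succ_pos _))
    (hfam ▸ B.linearIndependent.comp g hg.1)
    (by rw [hfam, hg.2.range_comp, B.span_eq])
  obtain ⟨r, a, w, hpa, hz, hli, hspan⟩ := hp
  have hrank' := finrank_range_pow_of_jordan e a w hz hli hspan
  obtain ⟨d, rfl⟩ : ∃ k, d = k + 1 := ⟨d - 1, by omega⟩
  have h1 := card_eq_add_two_mul_sum_sub a d
  have h2 := card_eq_add_two_mul_sum_sub (fun x : κ => D x.1) d
  simp only [← hrank'] at h1
  simp only [← hrank] at h2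
  have h3 : p.parts.count (d + 1) = (Finset.univ.filter fun i => a i = d + 1).card := by
    rw [← hpa, Multiset.count_map, Finset.card_def, Finset.filter_val]
    congr 1
    exact Multiset.filter_congr fun x _ => eq_comm
  have h4 : (Finset.univ.filter fun x : κ => D x.1 = d + 1).card =
      Module.finrank F (lowestSpace h f (d + 1)) := by
    rw [Finset.card_filter, Fintype.sum_sigma, Finset.sum_eq_single ⟨d, by omega⟩]
    · simp [D]
    · intro i _ hi
      have : D i ≠ d + 1 := fun h => hi (Fin.ext (by simpa [D] using h))
      simp [this]
    · simp
  rw [h3, ← h4]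
  omega

end Jordan

/-! ### Normal forms of bilinear forms -/

section NormalForms

variable {F K : Type*} [Field F] [AddCommGroup K] [Module F K]

theorem bilin_sum_smul {κ : Type*} [Fintype κ] (B : LinearMap.BilinForm F K) (w : κ → K)
    (x y : κ → F) :
    B (∑ i, x i • w i) (∑ j, y j • w j) = ∑ i, ∑ j, x i * (y j * B (w i) (w j)) := by
  simp only [map_sum, LinearMap.sum_apply, map_smul, LinearMap.smul_apply, smul_eq_mul,
    Finset.mul_sum]
  rw [Finset.sum_comm]
  exact Finset.sum_congr rfl fun i _ => Finset.sum_congr rfl fun j _ => mul_left_comm _ _ _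

variable [FiniteDimensional F K]

/-- A non-degenerate symmetric form over an algebraically closed field is isometric to the dot
product. -/
theorem exists_equiv_dotProduct [IsAlgClosed F] [CharZero F] (B : LinearMap.BilinForm F K)
    (hsymm : ∀ x y, B x y = B y x) (hnd : ∀ x, (∀ y, B x y = 0) → x = 0) {a : ℕ}
    (ha : Module.finrank F K = a) :
    ∃ α : (Fin a → F) ≃ₗ[F] K, ∀ x y, B (α x) (α y) = ∑ i, x i * y i := by
  subst ha
  have : Invertible (2 : F) := invertibleOfNonzero two_ne_zero
  obtain ⟨v, hv⟩ := LinearMap.BilinForm.exists_orthogonal_basis (B := B) ⟨hsymm⟩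
  have hv' : ∀ i j, i ≠ j → B (v i) (v j) = 0 := fun i j hij => hv hij
  have hne : ∀ i, B (v i) (v i) ≠ 0 := by
    intro i hi
    refine v.ne_zero i (hnd _ fun y => ?_)
    rw [← v.sum_repr y, map_sum]
    refine Finset.sum_eq_zero fun j _ => ?_
    rw [map_smul]
    by_cases hij : i = j
    · rw [← hij, hi, smul_zero]
    · rw [hv' i j hij, smul_zero]
  -- Square roots of `1 / B(v i, v i)` rescale the orthogonal basis to an orthonormal one.
  choose c hc using fun i => IsAlgClosed.exists_pow_nat_eq (B (v i) (v i))⁻¹ (n := 2) two_pos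
  have hc0 : ∀ i, c i ≠ 0 := by
    intro i h0
    have := hc i
    rw [h0] at this
    exact inv_ne_zero (hne i) (by rw [← this]; simp)
  let w := v.isUnitSMul fun i => (hc0 i).isUnit
  refine ⟨w.equivFun.symm, fun x y => ?_⟩
  rw [Module.Basis.equivFun_symm_apply, Module.Basis.equivFun_symm_apply, bilin_sum_smul]
  refine Finset.sum_congr rfl fun i _ => ?_
  rw [Finset.sum_eq_single i]
  · have h1 : B (w i) (w i) = 1 := by
      simp only [w, Module.Basis.isUnitSMul_apply, map_smul, LinearMap.smul_apply, smul_eq_mul]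
      rw [← mul_assoc, ← sq, hc, inv_mul_cancel₀ (hne i)]
    rw [h1, mul_one]
  · intro j _ hj
    simp [w, Module.Basis.isUnitSMul_apply, hv' i j hj.symm]
  · simp

/-- Split off a hyperbolic plane spanned by `x, y` with `B x y = 1` and recurse on its orthogonal
complement `ker G`. The space is quantified inside the induction because it changes at each stage.
-/
theorem exists_symplectic_family [CharZero F] (n : ℕ) :
    ∀ (K : Type*) [AddCommGroup K] [Module F K] [FiniteDimensional F K]
    (B : LinearMap.BilinForm F K) (_ : ∀ x y, B x y = -B y x)
    (_ : ∀ x, (∀ y, B x y = 0) → x = 0) (_ : Module.finrank F K = 2 * n),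
    ∃ x y : Fin n → K, (∀ i j, B (x i) (x j) = 0) ∧ (∀ i j, B (y i) (y j) = 0) ∧
      ∀ i j, B (x i) (y j) = if i = j then 1 else 0 := by
  induction n with
  | zero => exact fun K _ _ _ B _ _ _ => ⟨Fin.elim0, Fin.elim0, fun i => i.elim0,
      fun i => i.elim0, fun i => i.elim0⟩
  | succ n ih =>
    intro K _ _ _ B hskew hnd hK
    have hself : ∀ x, B x x = 0 := fun x => self_eq_neg.1 (hskew x x)
    have : Nontrivial K := Module.nontrivial_of_finrank_pos (R := F) (by omega)
    obtain ⟨x, hx⟩ := exists_ne (0 : K)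
    obtain ⟨y', hy'⟩ : ∃ y, B x y ≠ 0 := by
      by_contra! h
      exact hx (hnd x h)
    obtain ⟨y, hxy⟩ : ∃ y, B x y = 1 := ⟨(B x y')⁻¹ • y', by simp [hy']⟩
    have hyx : B y x = -1 := by rw [hskew, hxy]
    let G : K →ₗ[F] F × F := (B x).prod (B y)
    have hG : Function.Surjective G := by
      rintro ⟨s, r⟩
      refine ⟨s • y - r • x, ?_⟩
      simp [G, hxy, hyx, hself]
    have hdim : Module.finrank F (LinearMap.ker G) = 2 * n := by
      have h1 := LinearMap.finrank_range_add_finrank_ker G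
      rw [LinearMap.range_eq_top.2 hG, finrank_top, hK] at h1
      simp only [Module.finrank_prod, Module.finrank_self] at h1
      omega
    have hker : ∀ z : LinearMap.ker G, B x z = 0 ∧ B y z = 0 := fun z => by
      have h1 : (B x z, B y z) = (0, 0) := z.2
      simpa using h1
    obtain ⟨X, Y, hX, hY, hXY⟩ := ih (LinearMap.ker G)
      (B.restrict (LinearMap.ker G)) (fun a b => hskew a b) (by
        intro z hz
        refine Subtype.ext (hnd z fun u => ?_)
        -- The projection of `u` to the complement of the hyperbolic plane; it transfers
        -- non-degeneracy to `ker G`.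
        have hu : u - B x u • y + B y u • x ∈ LinearMap.ker G := by
          simp [G, hxy, hyx, hself]
        have h1 : B z (u - B x u • y + B y u • x) = 0 := hz ⟨_, hu⟩
        have h2 : B z x = 0 := by rw [hskew, (hker z).1, neg_zero]
        have h3 : B z y = 0 := by rw [hskew, (hker z).2, neg_zero]
        simpa [h2, h3] using h1) hdim
    simp only [LinearMap.BilinForm.restrict_apply, LinearMap.domRestrict_apply] at hX hY hXY
    refine ⟨Fin.cons x fun i => X i, Fin.cons y fun i => Y i, ?_, ?_, ?_⟩
    · intro i j
      refine Fin.cases ?_ (fun i => ?_) i <;> refine Fin.cases ?_ (fun j => ?_) j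
      · simp [hself]
      · simp [hker]
      · simp only [Fin.cons_succ, Fin.cons_zero]
        rw [hskew, (hker _).1, neg_zero]
      · simpa using hX i j
    · intro i j
      refine Fin.cases ?_ (fun i => ?_) i <;> refine Fin.cases ?_ (fun j => ?_) j
      · simp [hself]
      · simp [hker]
      · simp only [Fin.cons_succ, Fin.cons_zero]
        rw [hskew, (hker _).2, neg_zero]
      · simpa using hY i j
    · intro i j
      refine Fin.cases ?_ (fun i => ?_) i <;> refine Fin.cases ?_ (fun j => ?_) j
      · simp [hxy]
      · simp [hker, (Fin.succ_ne_zero j).symm]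
      · simp only [Fin.cons_succ, Fin.cons_zero, Fin.succ_ne_zero, if_false]
        rw [hskew, (hker _).2, neg_zero]
      · simpa using hXY i j

/-- A non-degenerate skew-symmetric form is isometric to the standard symplectic form. -/
theorem exists_equiv_symplectic [CharZero F] (B : LinearMap.BilinForm F K)
    (hskew : ∀ x y, B x y = -B y x) (hnd : ∀ x, (∀ y, B x y = 0) → x = 0) {n : ℕ}
    (hn : Module.finrank F K = 2 * n) :
    ∃ β : (Fin n ⊕ Fin n → F) ≃ₗ[F] K, ∀ x y, B (β x) (β y) =
      ∑ i, (x (Sum.inl i) * y (Sum.inr i) - x (Sum.inr i) * y (Sum.inl i)) := by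
  obtain ⟨X, Y, hX, hY, hXY⟩ := exists_symplectic_family n K B hskew hnd hn
  have hYX : ∀ i j, B (Y i) (X j) = if i = j then -1 else 0 := by
    intro i j
    rw [hskew, hXY]
    by_cases hij : i = j
    · simp [hij]
    · simp [hij, Ne.symm hij]
  let w : Fin n ⊕ Fin n → K := Sum.elim X Y
  have hli : LinearIndependent F w := by
    rw [Fintype.linearIndependent_iff]
    intro g hg
    rw [Fintype.sum_sum_type] at hg
    rintro (i | i)
    · have := congrArg (B (Y i)) hg
      simpa [w, map_sum, hYX, hY] using this
    · have := congrArg (B (X i)) hg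
      simpa [w, map_sum, hXY, hX] using this
  let b := basisOfLinearIndependentOfCardEqFinrank' w hli (by simp [hn, two_mul])
  have hb : ∀ i, b i = w i := fun i => by simp [b]
  refine ⟨b.equivFun.symm, fun x y => ?_⟩
  rw [Module.Basis.equivFun_symm_apply, Module.Basis.equivFun_symm_apply, bilin_sum_smul]
  simp [Fintype.sum_sum_type, hb, w, hX, hY, hXY, hYX, Finset.sum_add_distrib,
    sub_eq_add_neg, add_comm]

end NormalForms

/-! ### Parity -/

section Parity

variable {F V₀ V₁ : Type*} [Field F] [AddCommGroup V₀] [Module F V₀] [AddCommGroup V₁]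
  [Module F V₁]

theorem superSign_comm (i j : ZMod 2) : superSign F i j = superSign F j i := by
  rw [superSign, superSign, mul_comm]

theorem superSign_mul_self (i j : ZMod 2) : superSign F i j * superSign F i j = 1 := by
  rcases parity_cases i with rfl | rfl <;> rcases parity_cases j with rfl | rfl <;>
    simp [superSign_zero_left, superSign_zero_right, superSign_one_one]

variable (F V₀ V₁) in
/-- The endomorphism that acts as `(-1)^{kj}` on `V_j`. -/
def parityTwist (k : ZMod 2) : Module.End F (V₀ × V₁) :=
  projZero F V₀ V₁ + superSign F k 1 • projOne F V₀ V₁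

theorem parityTwist_apply (k : ZMod 2) (x : V₀ × V₁) :
    parityTwist F V₀ V₁ k x = (x.1, superSign F k 1 • x.2) := by
  ext <;> simp [parityTwist, projZero, projOne]

theorem parityTwist_zero : parityTwist F V₀ V₁ 0 = 1 := by
  apply LinearMap.ext
  intro x
  simp [parityTwist_apply, superSign_zero_left]

theorem parityTwist_parityTwist (k : ZMod 2) (x : V₀ × V₁) :
    parityTwist F V₀ V₁ k (parityTwist F V₀ V₁ k x) = x := by
  simp [parityTwist_apply, smul_smul, superSign_mul_self]

theorem parityTwist_comm (k l : ZMod 2) (x : V₀ × V₁) :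
    parityTwist F V₀ V₁ k (parityTwist F V₀ V₁ l x) =
      parityTwist F V₀ V₁ l (parityTwist F V₀ V₁ k x) := by
  simp [parityTwist_apply, smul_smul, mul_comm]

theorem parityTwist_of_mem {k j : ZMod 2} {x : V₀ × V₁} (hx : x ∈ vecPart F V₀ V₁ j) :
    parityTwist F V₀ V₁ k x = superSign F k j • x := by
  rcases parity_cases j with rfl | rfl
  · rw [mem_vecPart_zero] at hx
    ext <;> simp [parityTwist_apply, superSign_zero_right, hx]
  · rw [mem_vecPart_one] at hx
    ext <;> simp [parityTwist_apply, hx]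

theorem mem_vecPart_iff [CharZero F] {j : ZMod 2} {x : V₀ × V₁} :
    x ∈ vecPart F V₀ V₁ j ↔ parityTwist F V₀ V₁ 1 x = superSign F 1 j • x := by
  refine ⟨parityTwist_of_mem, fun h => ?_⟩
  have : IsAddTorsionFree V₀ := .of_isTorsionFree F V₀
  have : IsAddTorsionFree V₁ := .of_isTorsionFree F V₁
  rw [parityTwist_apply, superSign_one_one] at h
  rcases parity_cases j with rfl | rfl
  · rw [mem_vecPart_zero]
    have := congrArg Prod.snd h
    simpa [superSign_zero_right, neg_eq_self] using this
  · rw [mem_vecPart_one]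
    have := congrArg Prod.fst h
    simpa [superSign_one_one, self_eq_neg] using this

theorem parityTwist_map_of_mem {π k : ZMod 2} {z : Module.End F (V₀ × V₁)}
    (hz : z ∈ endPart F V₀ V₁ k) (x : V₀ × V₁) :
    parityTwist F V₀ V₁ π (z x) = superSign F π k • z (parityTwist F V₀ V₁ π x) := by
  have hom : ∀ j, ∀ x ∈ vecPart F V₀ V₁ j,
      parityTwist F V₀ V₁ π (z x) = superSign F π k • z (parityTwist F V₀ V₁ π x) := by
    intro j x hx
    rw [parityTwist_of_mem (hz j x hx), parityTwist_of_mem hx, map_smul, smul_smul]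
    congr 1
    rcases parity_cases π with rfl | rfl <;> rcases parity_cases j with rfl | rfl <;>
      rcases parity_cases k with rfl | rfl <;>
      simp [superSign_zero_left, superSign_zero_right, superSign_one_one,
        show (1 : ZMod 2) + 1 = 0 from rfl]
  have hx : x = (x.1, 0) + (0, x.2) := by simp
  rw [hx]
  simp only [map_add, smul_add]
  rw [hom 0 (x.1, 0) (mem_vecPart_zero.2 rfl), hom 1 (0, x.2) (mem_vecPart_one.2 rfl)]

/-- Parity is commutation up to sign with the parity operator, an identity of linear maps that can
be tested on spanning vectors that need not be homogeneous. -/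
theorem mem_endPart_iff [CharZero F] {k : ZMod 2} {z : Module.End F (V₀ × V₁)} :
    z ∈ endPart F V₀ V₁ k ↔ ∀ x, parityTwist F V₀ V₁ 1 (z x) =
      superSign F 1 k • z (parityTwist F V₀ V₁ 1 x) := by
  refine ⟨fun hz x => parityTwist_map_of_mem hz x, fun h j x hx => ?_⟩
  rw [mem_vecPart_iff, h, parityTwist_of_mem hx, map_smul, smul_smul]
  congr 1
  rcases parity_cases j with rfl | rfl <;> rcases parity_cases k with rfl | rfl <;>
    simp [superSign_zero_right, superSign_one_one, show (1 : ZMod 2) + 1 = 0 from rfl]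

/-- With the sign absorbed into the twist, the condition becomes an equality of two bilinear forms
on all of `V`, to be tested on strings. -/
theorem mem_ospPart_iff {φ : LinearMap.BilinForm F (V₀ × V₁)} {k : ZMod 2}
    {z : Module.End F (V₀ × V₁)} :
    z ∈ ospPart φ k ↔ z ∈ endPart F V₀ V₁ k ∧
      ∀ x y, φ (z x) y = -φ (parityTwist F V₀ V₁ k x) (z y) := by
  refine and_congr_right fun _ => ⟨fun h x y => ?_, fun h j x hx y => ?_⟩
  · have hx : x = (x.1, 0) + (0, x.2) := by simp
    have h0 := h 0 (x.1, 0) (mem_vecPart_zero.2 rfl) y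
    have h1 := h 1 (0, x.2) (mem_vecPart_one.2 rfl) y
    rw [hx]
    simp only [map_add, LinearMap.add_apply]
    rw [h0, h1, parityTwist_of_mem (j := 0) (mem_vecPart_zero.2 rfl),
      parityTwist_of_mem (j := 1) (mem_vecPart_one.2 rfl)]
    simp only [map_smul, LinearMap.smul_apply, smul_eq_mul]
    ring
  · rw [h, parityTwist_of_mem hx]
    simp

theorem endEven_of_mem {z : Module.End F (V₀ × V₁)} (hz : z ∈ endPart F V₀ V₁ 0) :
    endEven z = z := by
  conv_rhs => rw [← endEven_add_endOdd z, endOdd_eq_zero hz, add_zero]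

theorem endOdd_of_mem {z : Module.End F (V₀ × V₁)} (hz : z ∈ endPart F V₀ V₁ 1) :
    endOdd z = z := by
  conv_rhs => rw [← endEven_add_endOdd z, endEven_eq_zero hz, zero_add]

theorem endEven_add (y z : Module.End F (V₀ × V₁)) : endEven (y + z) = endEven y + endEven z := by
  simp only [endEven, mul_add, add_mul]
  abel

theorem endOdd_add (y z : Module.End F (V₀ × V₁)) : endOdd (y + z) = endOdd y + endOdd z := by
  simp only [endOdd, mul_add, add_mul]
  abel

theorem mem_osp_iff {φ : LinearMap.BilinForm F (V₀ × V₁)} {z : Module.End F (V₀ × V₁)} :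
    z ∈ (osp φ).toSubmodule ↔ endEven z ∈ ospPart φ 0 ∧ endOdd z ∈ ospPart φ 1 := by
  constructor
  · intro hz
    obtain ⟨a, ha, b, hb, rfl⟩ := Submodule.mem_sup.1 hz
    rw [endEven_add, endOdd_add, endEven_of_mem ha.1, endEven_eq_zero hb.1, endOdd_eq_zero ha.1,
      endOdd_of_mem hb.1, add_zero, zero_add]
    exact ⟨ha, hb⟩
  · rintro ⟨h0, h1⟩
    exact Submodule.mem_sup.2 ⟨_, h0, _, h1, endEven_add_endOdd z⟩

theorem mem_ospPart_of_mem_osp {φ : LinearMap.BilinForm F (V₀ × V₁)}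
    {z : Module.End F (V₀ × V₁)} (hz : z ∈ (osp φ).toSubmodule) (h0 : z ∈ endPart F V₀ V₁ 0) :
    z ∈ ospPart φ 0 := by
  have := (mem_osp_iff.1 hz).1
  rwa [endEven_of_mem h0] at this

theorem superComm_even_left {x : Module.End F (V₀ × V₁)} (hx : x ∈ endPart F V₀ V₁ 0)
    (z : Module.End F (V₀ × V₁)) : superComm F V₀ V₁ x z = x * z - z * x := by
  have key : superComm F V₀ V₁ x z =
    x * z - (endEven z * x + endOdd z * (endEven x - endOdd x)) := rfl
  rw [key, endEven_of_mem hx, endOdd_eq_zero hx, sub_zero, ← add_mul, endEven_add_endOdd]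

end Parity

/-! ### Adapted decompositions -/

section Adapted

variable {F V₀ V₁ : Type*} [Field F] [AddCommGroup V₀] [Module F V₀] [AddCommGroup V₁]
  [Module F V₁]

/-- A parametrization `ι`, of parity `π`, of the space of lowest weight vectors of weight `1 - d` by
a superspace `X`, such that `φ` induces the form `ψ` on `X`. -/
structure IsLowestChart (φ : LinearMap.BilinForm F (V₀ × V₁)) (e h f : Module.End F (V₀ × V₁))
    {X₀ X₁ : Type*} [AddCommGroup X₀] [Module F X₀] [AddCommGroup X₁] [Module F X₁] (d : ℕ)
    (π : ZMod 2) (ι : X₀ × X₁ →ₗ[F] V₀ × V₁) (ψ : LinearMap.BilinForm F (X₀ × X₁)) : Prop where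
  injective : Function.Injective ι
  range_eq : LinearMap.range ι = lowestSpace h f d
  twist : ∀ k x, parityTwist F V₀ V₁ k (ι x) = superSign F k π • ι (parityTwist F X₀ X₁ k x)
  form : ∀ x y, φ (ι x) ((e ^ (d - 1)) (ι y)) = ψ (parityTwist F X₀ X₁ π x) y

/-- A presentation of the superspace `V` with the action of an `𝔰𝔩₂`-triple by charts for its
spaces of lowest weight vectors. -/
structure IsAdapted (φ : LinearMap.BilinForm F (V₀ × V₁)) (e h f : Module.End F (V₀ × V₁))
    {I : Type*} [Fintype I] {X₀ X₁ : I → Type*} [∀ i, AddCommGroup (X₀ i)] [∀ i, Module F (X₀ i)]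
    [∀ i, AddCommGroup (X₁ i)] [∀ i, Module F (X₁ i)] (d : I → ℕ) (π : I → ZMod 2)
    (ι : ∀ i, X₀ i × X₁ i →ₗ[F] V₀ × V₁) (ψ : ∀ i, LinearMap.BilinForm F (X₀ i × X₁ i)) :
    Prop where
  triple : EndSl2Triple e h f
  e_mem : e ∈ ospPart φ 0
  h_mem : h ∈ ospPart φ 0
  pos : ∀ i, 0 < d i
  d_injective : Function.Injective d
  chart : ∀ i, IsLowestChart φ e h f (d i) (π i) (ι i) (ψ i)
  bijective : Function.Bijective (stringMap e d ι)

theorem form_apply_of_mem_even {φ : LinearMap.BilinForm F (V₀ × V₁)}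
    {z : Module.End F (V₀ × V₁)} (hz : z ∈ ospPart φ 0) (x y : V₀ × V₁) :
    φ (z x) y = -φ x (z y) := by
  have := (mem_ospPart_iff.1 hz).2 x y
  rwa [parityTwist_zero, Module.End.one_apply] at this

theorem form_pow_apply_of_mem_even {φ : LinearMap.BilinForm F (V₀ × V₁)}
    {z : Module.End F (V₀ × V₁)} (hz : z ∈ ospPart φ 0) (k : ℕ) (x y : V₀ × V₁) :
    φ ((z ^ k) x) y = (-1) ^ k * φ x ((z ^ k) y) := by
  induction k generalizing x with
  | zero => simp
  | succ k ih =>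
    have h1 : (z ^ (k + 1)) x = (z ^ k) (z x) := by rw [pow_succ, Module.End.mul_apply]
    rw [h1, ih, form_apply_of_mem_even hz, ← Module.End.mul_apply, ← pow_succ']
    ring

/-- The strings generated by lowest weight vectors pair to zero except in complementary
degrees. -/
theorem form_lowest_pow_eq_zero [CharZero F] [FiniteDimensional F V₀] [FiniteDimensional F V₁]
    {φ : LinearMap.BilinForm F (V₀ × V₁)} {e h f : Module.End F (V₀ × V₁)}
    (t : EndSl2Triple e h f) (he : e ∈ ospPart φ 0) (hh : h ∈ ospPart φ 0) {d d' k : ℕ}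
    (hd : 0 < d) (hd' : 0 < d') {w w' : V₀ × V₁} (hw : w ∈ lowestSpace h f d)
    (hw' : w' ∈ lowestSpace h f d') (hne : ¬(d = d' ∧ k + 1 = d)) :
    φ w ((e ^ k) w') = 0 := by
  by_contra h0
  have hk' : k < d' := by
    by_contra hk
    exact h0 (by rw [t.pow_e_lowest_of_le hw' hd' (by omega), map_zero])
  -- For `k ≥ d`, invariance moves `e^k` to the other argument, where it kills `w`.
  have hk : k < d := by
    by_contra hk
    apply h0
    have h1 := form_pow_apply_of_mem_even he k w w'
    rw [t.pow_e_lowest_of_le hw hd (by omega), map_zero, LinearMap.zero_apply, eq_comm,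
      mul_eq_zero] at h1
    exact h1.resolve_left (pow_ne_zero _ (by simp))
  -- Invariance under `h` makes the two weights cancel: `d + d' = 2k + 2`. With `k < d` and `k < d'`
  -- this forces `d = d' = k + 1`.
  have h1 := form_apply_of_mem_even hh w ((e ^ k) w')
  rw [(mem_lowestSpace.1 hw).2, t.h_pow_e, (mem_lowestSpace.1 hw').2] at h1
  simp only [map_smul, map_add, LinearMap.smul_apply, smul_eq_mul] at h1
  have h2 : ((d : F) + d' - (2 * k + 2)) * φ w ((e ^ k) w') = 0 := by linear_combination -h1
  have h3 : (d : F) + d' = 2 * k + 2 := sub_eq_zero.1 ((mul_eq_zero.1 h2).resolve_right h0)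
  have h4 : d + d' = 2 * k + 2 := by exact_mod_cast h3
  omega

/-! ### Endomorphisms commuting with the triple -/

namespace IsAdapted

variable {φ : LinearMap.BilinForm F (V₀ × V₁)} {e h f : Module.End F (V₀ × V₁)}
  {I : Type*} [Fintype I] {X₀ X₁ : I → Type*} [∀ i, AddCommGroup (X₀ i)] [∀ i, Module F (X₀ i)]
  [∀ i, AddCommGroup (X₁ i)] [∀ i, Module F (X₁ i)] {d : I → ℕ} {π : I → ZMod 2}
  {ι : ∀ i, X₀ i × X₁ i →ₗ[F] V₀ × V₁} {ψ : ∀ i, LinearMap.BilinForm F (X₀ i × X₁ i)}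

theorem mem (D : IsAdapted φ e h f d π ι ψ) (i : I) (x : X₀ i × X₁ i) :
    ι i x ∈ lowestSpace h f (d i) :=
  (D.chart i).range_eq ▸ LinearMap.mem_range_self _ x

theorem hom_ext (D : IsAdapted φ e h f d π ι ψ) {M : Type*} [AddCommGroup M] [Module F M]
    {y z : V₀ × V₁ →ₗ[F] M}
    (hyz : ∀ i (j : ℕ) x, y ((e ^ j) (ι i x)) = z ((e ^ j) (ι i x))) : y = z := by
  apply LinearMap.ext
  intro v
  obtain ⟨x, rfl⟩ := D.bijective.2 v
  rw [stringMap_apply]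
  simp only [map_sum, hyz]

theorem bilin_ext (D : IsAdapted φ e h f d π ι ψ) {A B : LinearMap.BilinForm F (V₀ × V₁)}
    (hAB : ∀ i (j : ℕ) x i' (j' : ℕ) x', A ((e ^ j) (ι i x)) ((e ^ j') (ι i' x')) =
      B ((e ^ j) (ι i x)) ((e ^ j') (ι i' x'))) : A = B :=
  D.hom_ext fun i j x => D.hom_ext fun i' j' x' => hAB i j x i' j' x'

/-- The endomorphism of `V` that extends a family of endomorphisms of the spaces of lowest weight
vectors and commutes with the `𝔰𝔩₂`-triple. -/
noncomputable def extend (D : IsAdapted φ e h f d π ι ψ)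
    (A : ∀ i, Module.End F (X₀ i × X₁ i)) : Module.End F (V₀ × V₁) :=
  (LinearEquiv.ofBijective (stringMap e d ι) D.bijective).conj
    (LinearMap.pi fun i => LinearMap.pi fun j => A i ∘ₗ LinearMap.proj j ∘ₗ LinearMap.proj i)

theorem parityTwist_pow_apply (D : IsAdapted φ e h f d π ι ψ) (k : ZMod 2) (i : I) (j : ℕ)
    (x : X₀ i × X₁ i) : parityTwist F V₀ V₁ k ((e ^ j) (ι i x)) =
      superSign F k (π i) • (e ^ j) (ι i (parityTwist F (X₀ i) (X₁ i) k x)) := by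
  have h1 : ∀ v, parityTwist F V₀ V₁ k ((e ^ j) v) = (e ^ j) (parityTwist F V₀ V₁ k v) := by
    intro v
    induction j with
    | zero => rfl
    | succ j ih =>
      rw [pow_succ', Module.End.mul_apply, Module.End.mul_apply,
        parityTwist_map_of_mem D.e_mem.1, superSign_zero_right, one_smul, ih]
  rw [h1, (D.chart i).twist, map_smul]

theorem form_pow_pow_self (D : IsAdapted φ e h f d π ι ψ) (i : I) {j j' : ℕ}
    (x x' : X₀ i × X₁ i) (hj : j + j' + 1 = d i) :
    φ ((e ^ j) (ι i x)) ((e ^ j') (ι i x')) =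
      (-1) ^ j * ψ i (parityTwist F (X₀ i) (X₁ i) (π i) x) x' := by
  rw [form_pow_apply_of_mem_even D.e_mem, ← Module.End.mul_apply, ← pow_add,
    show j + j' = d i - 1 by omega, (D.chart i).form]

variable [CharZero F] [FiniteDimensional F V₀] [FiniteDimensional F V₁]

/-- For `j ≥ d i` both sides are zero, so later computations need no bound on `j`. -/
theorem extend_pow_apply (D : IsAdapted φ e h f d π ι ψ) (A : ∀ i, Module.End F (X₀ i × X₁ i))
    (i : I) (j : ℕ) (x : X₀ i × X₁ i) :
    D.extend A ((e ^ j) (ι i x)) = (e ^ j) (ι i (A i x)) := by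
  classical
  by_cases hj : j < d i
  · have h1 := stringMap_single (e := e) (d := d) (ι := ι) i ⟨j, hj⟩ x
    have h2 := stringMap_single (e := e) (d := d) (ι := ι) i ⟨j, hj⟩ (A i x)
    simp only at h1 h2
    rw [← h1, ← h2, extend, LinearEquiv.conj_apply_apply]
    change stringMap e d ι _ = _
    congr 1
    have h3 : (LinearEquiv.ofBijective (stringMap e d ι) D.bijective).symm
        (stringMap e d ι (Pi.single i (Pi.single ⟨j, hj⟩ x))) =
          Pi.single i (Pi.single ⟨j, hj⟩ x) :=
      (LinearEquiv.ofBijective (stringMap e d ι) D.bijective).symm_apply_apply _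
    rw [h3]
    funext i' j'
    simp only [LinearMap.pi_apply, LinearMap.comp_apply, LinearMap.proj_apply]
    by_cases hi : i' = i
    · subst hi
      by_cases hj' : j' = ⟨j, hj⟩
      · subst hj'
        simp
      · simp [Pi.single_eq_of_ne hj']
    · simp [Pi.single_eq_of_ne hi]
  · rw [D.triple.pow_e_lowest_of_le (D.mem i x) (D.pos i) (by omega),
      D.triple.pow_e_lowest_of_le (D.mem i _) (D.pos i) (by omega), map_zero]

theorem extend_apply (D : IsAdapted φ e h f d π ι ψ) (A : ∀ i, Module.End F (X₀ i × X₁ i))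
    (i : I) (x : X₀ i × X₁ i) : D.extend A (ι i x) = ι i (A i x) := by
  simpa using D.extend_pow_apply A i 0 x

theorem extend_add (D : IsAdapted φ e h f d π ι ψ) (A B : ∀ i, Module.End F (X₀ i × X₁ i)) :
    D.extend (A + B) = D.extend A + D.extend B :=
  D.hom_ext fun i j x => by simp [extend_pow_apply]

theorem extend_sub (D : IsAdapted φ e h f d π ι ψ) (A B : ∀ i, Module.End F (X₀ i × X₁ i)) :
    D.extend (A - B) = D.extend A - D.extend B :=
  D.hom_ext fun i j x => by simp [extend_pow_apply]

theorem extend_smul (D : IsAdapted φ e h f d π ι ψ) (c : F)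
    (A : ∀ i, Module.End F (X₀ i × X₁ i)) : D.extend (c • A) = c • D.extend A :=
  D.hom_ext fun i j x => by simp [extend_pow_apply]

theorem extend_mul (D : IsAdapted φ e h f d π ι ψ) (A B : ∀ i, Module.End F (X₀ i × X₁ i)) :
    D.extend (A * B) = D.extend A * D.extend B :=
  D.hom_ext fun i j x => by simp [extend_pow_apply]

theorem extend_injective (D : IsAdapted φ e h f d π ι ψ) : Function.Injective D.extend := by
  intro A B hAB
  funext i
  apply LinearMap.ext
  intro x
  apply (D.chart i).injective
  rw [← D.extend_apply, ← D.extend_apply, hAB]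

/-- A change of parity on the chart contributes the same sign to both sides, so it does not affect
the parity of an endomorphism. -/
theorem extend_mem_endPart_iff (D : IsAdapted φ e h f d π ι ψ) {k : ZMod 2}
    {A : ∀ i, Module.End F (X₀ i × X₁ i)} :
    D.extend A ∈ endPart F V₀ V₁ k ↔ ∀ i, A i ∈ endPart F (X₀ i) (X₁ i) k := by
  simp only [mem_endPart_iff (k := k)]
  have hs : ∀ i, superSign F 1 (π i) ≠ 0 := fun i h0 => by
    have := superSign_mul_self (F := F) 1 (π i)
    simp [h0] at this
  constructor
  · intro hA i x
    apply (D.chart i).injective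
    have h1 := hA (ι i x)
    rw [D.extend_apply, (D.chart i).twist, (D.chart i).twist, map_smul, D.extend_apply,
      smul_comm] at h1
    rw [map_smul]
    exact smul_right_injective _ (hs i) h1
  · intro hA
    have h1 : parityTwist F V₀ V₁ 1 * D.extend A =
        superSign F 1 k • (D.extend A * parityTwist F V₀ V₁ 1) := by
      refine D.hom_ext fun i j x => ?_
      simp only [Module.End.mul_apply, LinearMap.smul_apply, D.extend_pow_apply,
        D.parityTwist_pow_apply, hA, map_smul]
      rw [smul_comm]
    exact fun x => congrArg (fun z : Module.End F (V₀ × V₁) => z x) h1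

theorem form_pow_pow (D : IsAdapted φ e h f d π ι ψ) (i : I) (j : ℕ) (x : X₀ i × X₁ i) (i' : I)
    (j' : ℕ) (x' : X₀ i' × X₁ i') (hne : ¬(i = i' ∧ j + j' + 1 = d i)) :
    φ ((e ^ j) (ι i x)) ((e ^ j') (ι i' x')) = 0 := by
  rw [form_pow_apply_of_mem_even D.e_mem, ← Module.End.mul_apply, ← pow_add,
    form_lowest_pow_eq_zero D.triple D.e_mem D.h_mem (D.pos i) (D.pos i') (D.mem i x)
      (D.mem i' x') (fun h => hne ⟨D.d_injective h.1, h.2⟩), mul_zero]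

/-- The form `φ` is determined by the `ψ i`: strings in non-complementary degrees are orthogonal,
and in complementary degrees `φ` is `ψ i` up to a sign and a twist. The extension acts on each
string through `A i`, so invariance of `φ` reduces to invariance of each `ψ i`. -/
theorem extend_mem_ospPart_iff (D : IsAdapted φ e h f d π ι ψ) {k : ZMod 2}
    {A : ∀ i, Module.End F (X₀ i × X₁ i)} :
    D.extend A ∈ ospPart φ k ↔ ∀ i, A i ∈ ospPart (ψ i) k := by
  simp only [mem_ospPart_iff, D.extend_mem_endPart_iff, forall_and]
  refine and_congr_right fun hA => ⟨fun hφ i x y => ?_, fun hψ => ?_⟩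
  -- Twisting `x` beforehand undoes the twist in the chart's form; what remains is the common factor
  -- `superSign F k (π i)`, cancelled at the end.
  · have h1 := hφ (ι i (parityTwist F (X₀ i) (X₁ i) (π i) x)) ((e ^ (d i - 1)) (ι i y))
    rw [D.extend_apply, D.extend_pow_apply, (D.chart i).form, (D.chart i).twist, map_smul,
      LinearMap.smul_apply,
      (D.chart i).form, parityTwist_map_of_mem (hA i), parityTwist_parityTwist, parityTwist_comm,
      parityTwist_parityTwist, map_smul, LinearMap.smul_apply, superSign_comm, smul_eq_mul,
      smul_eq_mul, ← mul_neg] at h1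
    refine mul_left_cancel₀ (fun h0 => ?_) h1
    have := superSign_mul_self (F := F) k (π i)
    simp [h0] at this
  · have key : φ.compl₁₂ (D.extend A) LinearMap.id =
        -φ.compl₁₂ (parityTwist F V₀ V₁ k) (D.extend A) := by
      refine D.bilin_ext fun i j x i' j' x' => ?_
      simp only [LinearMap.compl₁₂_apply, LinearMap.id_apply, LinearMap.neg_apply,
        D.extend_pow_apply, D.parityTwist_pow_apply, map_smul, LinearMap.smul_apply]
      by_cases hi : i = i' ∧ j + j' + 1 = d i
      · obtain ⟨rfl, hj⟩ := hi
        rw [D.form_pow_pow_self i _ _ hj, D.form_pow_pow_self i _ _ hj,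
          parityTwist_map_of_mem (hA i), map_smul, LinearMap.smul_apply, hψ,
          parityTwist_comm (π i) k, superSign_comm (π i) k, smul_eq_mul, smul_eq_mul]
        ring
      · rw [D.form_pow_pow i j _ i' j' _ hi, D.form_pow_pow i j _ i' j' _ hi]
        simp
    intro x y
    exact congrArg (fun B : LinearMap.BilinForm F (V₀ × V₁) => B x y) key

theorem endEven_extend (D : IsAdapted φ e h f d π ι ψ) (A : ∀ i, Module.End F (X₀ i × X₁ i)) :
    endEven (D.extend A) = D.extend fun i => endEven (A i) := by
  have h1 : A = (fun i => endEven (A i)) + fun i => endOdd (A i) :=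
    funext fun i => (endEven_add_endOdd (A i)).symm
  conv_lhs => rw [h1, D.extend_add, endEven_add]
  rw [endEven_of_mem (D.extend_mem_endPart_iff.2 fun i => endEven_mem (A i)),
    endEven_eq_zero (D.extend_mem_endPart_iff.2 fun i => endOdd_mem (A i)), add_zero]

theorem endOdd_extend (D : IsAdapted φ e h f d π ι ψ) (A : ∀ i, Module.End F (X₀ i × X₁ i)) :
    endOdd (D.extend A) = D.extend fun i => endOdd (A i) := by
  have h1 : A = (fun i => endEven (A i)) + fun i => endOdd (A i) :=
    funext fun i => (endEven_add_endOdd (A i)).symm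
  conv_lhs => rw [h1, D.extend_add, endOdd_add]
  rw [endOdd_eq_zero (D.extend_mem_endPart_iff.2 fun i => endEven_mem (A i)),
    endOdd_of_mem (D.extend_mem_endPart_iff.2 fun i => endOdd_mem (A i)), zero_add]

theorem extend_mem_osp_iff (D : IsAdapted φ e h f d π ι ψ)
    {A : ∀ i, Module.End F (X₀ i × X₁ i)} :
    D.extend A ∈ (osp φ).toSubmodule ↔ ∀ i, A i ∈ (osp (ψ i)).toSubmodule := by
  simp only [mem_osp_iff, D.endEven_extend, D.endOdd_extend, D.extend_mem_ospPart_iff, forall_and]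

theorem superComm_extend (D : IsAdapted φ e h f d π ι ψ)
    (A B : ∀ i, Module.End F (X₀ i × X₁ i)) :
    superComm F V₀ V₁ (D.extend A) (D.extend B) =
      D.extend fun i => superComm F (X₀ i) (X₁ i) (A i) (B i) := by
  have key : superComm F V₀ V₁ (D.extend A) (D.extend B) =
      D.extend A * D.extend B - (endEven (D.extend B) * D.extend A +
        endOdd (D.extend B) * (endEven (D.extend A) - endOdd (D.extend A))) := rfl
  rw [key]
  simp only [endEven_extend, endOdd_extend, ← extend_mul, ← extend_sub, ← extend_add]
  rfl

theorem extend_comm (D : IsAdapted φ e h f d π ι ψ) (A : ∀ i, Module.End F (X₀ i × X₁ i)) :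
    e * D.extend A = D.extend A * e ∧ h * D.extend A = D.extend A * h ∧
      f * D.extend A = D.extend A * f := by
  refine ⟨D.hom_ext fun i j x => ?_, D.hom_ext fun i j x => ?_, D.hom_ext fun i j x => ?_⟩
  · simp only [Module.End.mul_apply, D.extend_pow_apply]
    simp only [← Module.End.mul_apply e, ← pow_succ', D.extend_pow_apply]
  · simp only [Module.End.mul_apply, D.extend_pow_apply, D.triple.h_pow_e,
      (mem_lowestSpace.1 (D.mem i _)).2, map_smul, map_add]
  · simp only [Module.End.mul_apply, D.extend_pow_apply]
    cases j with
    | zero => simp [(mem_lowestSpace.1 (D.mem i _)).1]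
    | succ j => simp only [D.triple.f_pow_e_lowest (D.mem i _), map_smul, D.extend_pow_apply]

/-- The lowest spaces are cut out by `f` and `h`, so `z` preserves them; commuting with `e` then
determines `z` on the strings they generate. -/
theorem exists_eq_extend (D : IsAdapted φ e h f d π ι ψ) {z : Module.End F (V₀ × V₁)}
    (he : e * z = z * e) (hh : h * z = z * h) (hf : f * z = z * f) :
    ∃ A, z = D.extend A := by
  have hcomm : ∀ {y : Module.End F (V₀ × V₁)}, y * z = z * y → ∀ v, y (z v) = z (y v) :=
    fun hy v => congrArg (fun g : Module.End F (V₀ × V₁) => g v) hy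
  have hz : ∀ i x, z (ι i x) ∈ LinearMap.range (ι i) := by
    intro i x
    obtain ⟨h1, h2⟩ := mem_lowestSpace.1 (D.mem i x)
    rw [(D.chart i).range_eq, mem_lowestSpace, hcomm hf, hcomm hh, h1, h2, map_zero, map_smul]
    exact ⟨rfl, rfl⟩
  refine ⟨fun i => (LinearEquiv.ofInjective (ι i) ((D.chart i).injective)).symm ∘ₗ
    LinearMap.codRestrict _ (z ∘ₗ ι i) (hz i), D.hom_ext fun i j x => ?_⟩
  rw [D.extend_pow_apply]
  have hpow : ∀ v, z ((e ^ j) v) = (e ^ j) (z v) := by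
    intro v
    have : Commute (e ^ j) z := Commute.pow_left he j
    exact (hcomm this.eq v).symm
  rw [hpow]
  congr 1
  have := (LinearEquiv.ofInjective (ι i) ((D.chart i).injective)).apply_symm_apply
    (LinearMap.codRestrict _ (z ∘ₗ ι i) (hz i) x)
  exact (congrArg Subtype.val this).symm

end IsAdapted

end Adapted

/-! ### The centralizer as a product -/

section Equivalences

variable {F L M N : Type*} [Field F] [AddCommGroup L] [Module F L] [LieSuperalgebra F L]
  [AddCommGroup M] [Module F M] [LieSuperalgebra F M] [AddCommGroup N] [Module F N]
  [LieSuperalgebra F N]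

/-- The inverse of an isomorphism of Lie superalgebras. -/
def LieSuperEquiv.symm (E : LieSuperEquiv F L M) : LieSuperEquiv F M L where
  toLinearEquiv := E.toLinearEquiv.symm
  map_part i x := by
    have h := E.map_part i (E.toLinearEquiv.symm x)
    exact (h.symm.trans (by
      rw [show E.toFun (E.toLinearEquiv.symm x) = x from E.toLinearEquiv.apply_symm_apply x]))
  map_bracket x y := by
    apply E.toLinearEquiv.injective
    have h := E.map_bracket (E.toLinearEquiv.symm x) (E.toLinearEquiv.symm y)
    have hx : E.toFun (E.toLinearEquiv.symm x) = x := E.toLinearEquiv.apply_symm_apply x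
    have hy : E.toFun (E.toLinearEquiv.symm y) = y := E.toLinearEquiv.apply_symm_apply y
    rw [hx, hy] at h
    exact (E.toLinearEquiv.apply_symm_apply _).trans h.symm

/-- The composition of isomorphisms of Lie superalgebras. -/
def LieSuperEquiv.trans (E : LieSuperEquiv F L M) (E' : LieSuperEquiv F M N) :
    LieSuperEquiv F L N where
  toLinearEquiv := E.toLinearEquiv.trans E'.toLinearEquiv
  map_part i x := (E'.map_part i _).trans (E.map_part i x)
  map_bracket x y := (congrArg E'.toFun (E.map_bracket x y)).trans (E'.map_bracket _ _)

/-- A product over a disjoint union is the product of the products. -/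
def LieSuperEquiv.sumPiEquivProdPi {I J : Type*} (A : I ⊕ J → Type*) [∀ i, AddCommGroup (A i)]
    [∀ i, Module F (A i)] [∀ i, LieSuperalgebra F (A i)] :
    LieSuperEquiv F (∀ i, A i) ((∀ i, A (Sum.inl i)) × ∀ j, A (Sum.inr j)) where
  toLinearEquiv := LinearEquiv.sumPiEquivProdPi F I J A
  map_part k x := by
    constructor
    · rintro ⟨h1, h2⟩ (i | j) -
      · exact h1 i trivial
      · exact h2 j trivial
    · intro h
      exact ⟨fun i _ => h (Sum.inl i) trivial, fun j _ => h (Sum.inr j) trivial⟩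
  map_bracket x y := rfl

end Equivalences

/-! ### The centralizer of an `𝔰𝔩₂`-triple in `𝔬𝔰𝔭(V, φ)` -/

section Centralizer

variable {F V₀ V₁ : Type*} [Field F] [AddCommGroup V₀] [Module F V₀] [AddCommGroup V₁]
  [Module F V₁] {φ : LinearMap.BilinForm F (V₀ × V₁)} {e h f : osp φ}

theorem IsEvenSl2Triple.mem_ospPart (t : IsEvenSl2Triple F e h f) :
    (e : Module.End F (V₀ × V₁)) ∈ ospPart φ 0 ∧ (h : Module.End F (V₀ × V₁)) ∈ ospPart φ 0 ∧
      (f : Module.End F (V₀ × V₁)) ∈ ospPart φ 0 :=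
  ⟨mem_ospPart_of_mem_osp e.2 t.even_e, mem_ospPart_of_mem_osp h.2 t.even_h,
    mem_ospPart_of_mem_osp f.2 t.even_f⟩

theorem IsEvenSl2Triple.endSl2Triple (t : IsEvenSl2Triple F e h f) :
    EndSl2Triple (e : Module.End F (V₀ × V₁)) (h : Module.End F (V₀ × V₁))
      (f : Module.End F (V₀ × V₁)) := by
  have h1 : superComm F V₀ V₁ e f = h := congrArg Subtype.val t.bracket_e_f
  have h2 : superComm F V₀ V₁ h e = (2 : F) • (e : Module.End F (V₀ × V₁)) :=
    congrArg Subtype.val t.bracket_h_e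
  have h3 : superComm F V₀ V₁ h f = -((2 : F) • (f : Module.End F (V₀ × V₁))) :=
    congrArg Subtype.val t.bracket_h_f
  rw [superComm_even_left (x := (e : Module.End F (V₀ × V₁))) t.even_e] at h1
  rw [superComm_even_left (x := (h : Module.End F (V₀ × V₁))) t.even_h] at h2 h3
  refine ⟨fun u => ?_, fun u => ?_, fun u => ?_⟩
  · rw [← h1]
    simp
  · have := congrArg (fun z : Module.End F (V₀ × V₁) => z u) h2
    simp only [LinearMap.sub_apply, Module.End.mul_apply, LinearMap.smul_apply] at this
    rw [← this]
    abel
  · have := congrArg (fun z : Module.End F (V₀ × V₁) => z u) h3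
    simp only [LinearMap.sub_apply, Module.End.mul_apply, LinearMap.smul_apply,
      LinearMap.neg_apply] at this
    rw [sub_eq_add_neg, ← this]
    abel

theorem IsEvenSl2Triple.mem_centralizer_iff (t : IsEvenSl2Triple F e h f) {z : osp φ} :
    z ∈ t.centralizer.toSubmodule ↔
      (e : Module.End F (V₀ × V₁)) * z = z * (e : Module.End F (V₀ × V₁)) ∧
      (h : Module.End F (V₀ × V₁)) * z = z * (h : Module.End F (V₀ × V₁)) ∧
      (f : Module.End F (V₀ × V₁)) * z = z * (f : Module.End F (V₀ × V₁)) := by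
  have key : ∀ x : osp φ, x ∈ superPart F (osp φ) 0 → (superBracket F x z = 0 ↔
      (x : Module.End F (V₀ × V₁)) * z = z * (x : Module.End F (V₀ × V₁))) := by
    intro x hx
    have h1 : (superBracket F x z : osp φ) = 0 ↔ superComm F V₀ V₁ x z = 0 := Subtype.ext_iff
    rw [h1, superComm_even_left (x := (x : Module.End F (V₀ × V₁))) hx, sub_eq_zero]
  have h1 : z ∈ t.centralizer.toSubmodule ↔ ∀ x ∈ ({e, h, f} : Set (osp φ)),
    superBracket F x z = 0 := Iff.rfl
  rw [h1]
  simp only [Set.mem_insert_iff, Set.mem_singleton_iff, forall_eq_or_imp, forall_eq]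
  rw [key e t.even_e, key h t.even_h, key f t.even_f]

variable [CharZero F] [FiniteDimensional F V₀] [FiniteDimensional F V₁]
  {I : Type*} [Fintype I] {X₀ X₁ : I → Type*} [∀ i, AddCommGroup (X₀ i)] [∀ i, Module F (X₀ i)]
  [∀ i, AddCommGroup (X₁ i)] [∀ i, Module F (X₁ i)] {d : I → ℕ} {π : I → ZMod 2}
  {ι : ∀ i, X₀ i × X₁ i →ₗ[F] V₀ × V₁} {ψ : ∀ i, LinearMap.BilinForm F (X₀ i × X₁ i)}

/-- The centralizer of the triple is the product of the orthosymplectic superalgebras of the spaces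
of lowest weight vectors. -/
theorem IsAdapted.nonempty_equiv (t : IsEvenSl2Triple F e h f)
    (D : IsAdapted φ (e : Module.End F (V₀ × V₁)) (h : Module.End F (V₀ × V₁))
      (f : Module.End F (V₀ × V₁)) d π ι ψ) :
    Nonempty (LieSuperEquiv F (∀ i, osp (ψ i)) t.centralizer) := by
  let G : (∀ i, osp (ψ i)) →ₗ[F] t.centralizer :=
    { toFun := fun A => ⟨⟨D.extend fun i => A i, D.extend_mem_osp_iff.2 fun i => (A i).2⟩,
        t.mem_centralizer_iff.2 (D.extend_comm _)⟩
      map_add' := fun A B => Subtype.ext (Subtype.ext (D.extend_add _ _))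
      map_smul' := fun c A => Subtype.ext (Subtype.ext (D.extend_smul _ _)) }
  have hG : Function.Bijective G := by
    constructor
    · intro A B hAB
      have h1 : D.extend (fun i => (A i : Module.End F (X₀ i × X₁ i))) =
          D.extend fun i => (B i : Module.End F (X₀ i × X₁ i)) :=
        congrArg (fun z : t.centralizer => ((z : osp φ) : Module.End F (V₀ × V₁))) hAB
      funext i
      exact Subtype.ext (congrFun (D.extend_injective h1) i)
    · rintro ⟨⟨z, hz⟩, hc⟩
      obtain ⟨h1, h2, h3⟩ := t.mem_centralizer_iff.1 hc
      obtain ⟨A, rfl⟩ := D.exists_eq_extend h1 h2 h3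
      exact ⟨fun i => ⟨A i, D.extend_mem_osp_iff.1 hz i⟩, rfl⟩
  refine ⟨⟨LinearEquiv.ofBijective G hG, fun k A => ?_, fun A B => ?_⟩⟩
  · have h1 : G A ∈ superPart F t.centralizer k ↔ D.extend (fun i => (A i).1) ∈
      endPart F V₀ V₁ k := Iff.rfl
    have h2 : A ∈ superPart F (∀ i, osp (ψ i)) k ↔ ∀ i, (A i).1 ∈
        endPart F (X₀ i) (X₁ i) k :=
      ⟨fun h i => h i trivial, fun h i _ => h i⟩
    exact h1.trans (D.extend_mem_endPart_iff.trans h2.symm)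
  · exact Subtype.ext (Subtype.ext (D.superComm_extend _ _).symm)

end Centralizer

/-! ### Charts for the spaces of lowest weight vectors -/

section Charts

theorem stdForm_apply {F : Type*} [Field F] (a b : ℕ) (x y : (Fin a → F) × (Fin b ⊕ Fin b → F)) :
    stdForm F a b x y = ∑ i, x.1 i * y.1 i +
      ∑ i, (x.2 (Sum.inl i) * y.2 (Sum.inr i) - x.2 (Sum.inr i) * y.2 (Sum.inl i)) := rfl

variable {F V₀ V₁ : Type*} [Field F] [AddCommGroup V₀] [Module F V₀] [AddCommGroup V₁]
  [Module F V₁]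

theorem apply_of_mem_even {z : Module.End F (V₀ × V₁)} (hz : z ∈ endPart F V₀ V₁ 0) (x : V₀)
    (y : V₁) : z (x, y) = (blockZero z x, blockOne z y) := by
  have h0 : (z (x, 0)).2 = 0 := mem_vecPart_zero.1 (hz 0 (x, 0) (mem_vecPart_zero.2 rfl))
  have h1 : (z (0, y)).1 = 0 := mem_vecPart_one.1 (hz 1 (0, y) (mem_vecPart_one.2 rfl))
  have h : z (x, y) = z (x, 0) + z (0, y) := by rw [← map_add]; simp
  rw [h]
  ext <;> simp [blockZero, blockOne, h0, h1]

theorem pow_apply_of_mem_even {z : Module.End F (V₀ × V₁)} (hz : z ∈ endPart F V₀ V₁ 0) (k : ℕ)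
    (x : V₀) (y : V₁) : (z ^ k) (x, y) = ((blockZero z ^ k) x, (blockOne z ^ k) y) := by
  induction k with
  | zero => simp
  | succ k ih =>
    rw [pow_succ', Module.End.mul_apply, ih, apply_of_mem_even hz]
    simp [pow_succ', Module.End.mul_apply]

theorem IsOrthosymplecticForm.apply {φ : LinearMap.BilinForm F (V₀ × V₁)}
    (hφ : IsOrthosymplecticForm φ) (x x' : V₀) (y y' : V₁) :
    φ (x, y) (x', y') = φ (x, 0) (x', 0) + φ (0, y) (0, y') := by
  have h1 : ((x, y) : V₀ × V₁) = (x, 0) + (0, y) := by simp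
  have h2 : ((x', y') : V₀ × V₁) = (x', 0) + (0, y') := by simp
  rw [h1, h2]
  simp only [map_add, LinearMap.add_apply, hφ.even_odd, hφ.odd_even, add_zero, zero_add]

variable {φ : LinearMap.BilinForm F (V₀ × V₁)} {e h f : Module.End F (V₀ × V₁)}

theorem EndSl2Triple.blockZero (t : EndSl2Triple e h f) (he : e ∈ endPart F V₀ V₁ 0)
    (hh : h ∈ endPart F V₀ V₁ 0) (hf : f ∈ endPart F V₀ V₁ 0) :
    EndSl2Triple (blockZero e) (blockZero h) (blockZero f) := by
  refine ⟨fun u => ?_, fun u => ?_, fun u => ?_⟩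
  · simpa [apply_of_mem_even, he, hh, hf] using congrArg Prod.fst (t.e_f (u, 0))
  · simpa [apply_of_mem_even, he, hh, hf] using congrArg Prod.fst (t.h_e (u, 0))
  · simpa [apply_of_mem_even, he, hh, hf] using congrArg Prod.fst (t.h_f (u, 0))

theorem EndSl2Triple.blockOne (t : EndSl2Triple e h f) (he : e ∈ endPart F V₀ V₁ 0)
    (hh : h ∈ endPart F V₀ V₁ 0) (hf : f ∈ endPart F V₀ V₁ 0) :
    EndSl2Triple (blockOne e) (blockOne h) (blockOne f) := by
  refine ⟨fun u => ?_, fun u => ?_, fun u => ?_⟩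
  · simpa [apply_of_mem_even, he, hh, hf] using congrArg Prod.snd (t.e_f (0, u))
  · simpa [apply_of_mem_even, he, hh, hf] using congrArg Prod.snd (t.h_e (0, u))
  · simpa [apply_of_mem_even, he, hh, hf] using congrArg Prod.snd (t.h_f (0, u))

theorem mem_lowestSpace_prod (hh : h ∈ endPart F V₀ V₁ 0) (hf : f ∈ endPart F V₀ V₁ 0) {d : ℕ}
    {x : V₀} {y : V₁} : (x, y) ∈ lowestSpace h f d ↔
      x ∈ lowestSpace (blockZero h) (blockZero f) d ∧
        y ∈ lowestSpace (blockOne h) (blockOne f) d := by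
  simp only [mem_lowestSpace, apply_of_mem_even hh, apply_of_mem_even hf, Prod.smul_mk,
    Prod.mk.injEq, Prod.mk_eq_zero]
  tauto

/-- The form `(x, y) ↦ φ(x, e^(d - 1) y)` on the even lowest weight vectors. -/
def lowestFormZero (φ : LinearMap.BilinForm F (V₀ × V₁)) (e h f : Module.End F (V₀ × V₁)) (d : ℕ) :
    LinearMap.BilinForm F (lowestSpace (blockZero h) (blockZero f) d) :=
  φ.compl₁₂ (LinearMap.inl F V₀ V₁ ∘ₗ Submodule.subtype _)
    (LinearMap.inl F V₀ V₁ ∘ₗ (blockZero e ^ (d - 1)) ∘ₗ Submodule.subtype _)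

/-- The form `(x, y) ↦ φ(x, e^(d - 1) y)` on the odd lowest weight vectors. -/
def lowestFormOne (φ : LinearMap.BilinForm F (V₀ × V₁)) (e h f : Module.End F (V₀ × V₁)) (d : ℕ) :
    LinearMap.BilinForm F (lowestSpace (blockOne h) (blockOne f) d) :=
  φ.compl₁₂ (LinearMap.inr F V₀ V₁ ∘ₗ Submodule.subtype _)
    (LinearMap.inr F V₀ V₁ ∘ₗ (blockOne e ^ (d - 1)) ∘ₗ Submodule.subtype _)

theorem lowestFormZero_apply {d : ℕ} (x y : lowestSpace (blockZero h) (blockZero f) d) :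
    lowestFormZero φ e h f d x y = φ (x, 0) ((blockZero e ^ (d - 1)) y, 0) := rfl

theorem lowestFormOne_apply {d : ℕ} (x y : lowestSpace (blockOne h) (blockOne f) d) :
    lowestFormOne φ e h f d x y = φ (0, x) (0, (blockOne e ^ (d - 1)) y) := rfl

theorem form_lowest_eq (hφ : IsOrthosymplecticForm φ) (he : e ∈ ospPart φ 0) {d : ℕ}
    (x x' : lowestSpace (blockZero h) (blockZero f) d)
    (y y' : lowestSpace (blockOne h) (blockOne f) d) :
    φ ((x : V₀), (y : V₁)) ((e ^ (d - 1)) ((x' : V₀), (y' : V₁))) =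
      lowestFormZero φ e h f d x x' + lowestFormOne φ e h f d y y' := by
  rw [pow_apply_of_mem_even he.1, hφ.apply, lowestFormZero_apply, lowestFormOne_apply]

/-- Each of the `d - 1` factors `e` changes the sign when moved across `φ`: the form on the even
lowest weight vectors is symmetric for odd `d` and skew for even `d`. On the odd ones it is the
reverse. -/
theorem lowestFormZero_swap (hφ : IsOrthosymplecticForm φ) (he : e ∈ ospPart φ 0) {d : ℕ}
    (x y : lowestSpace (blockZero h) (blockZero f) d) :
    lowestFormZero φ e h f d x y = (-1) ^ (d - 1) * lowestFormZero φ e h f d y x := by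
  rw [lowestFormZero_apply, lowestFormZero_apply, hφ.symm_even]
  have h1 := form_pow_apply_of_mem_even he (d - 1) ((y : V₀), (0 : V₁)) ((x : V₀), (0 : V₁))
  simpa only [pow_apply_of_mem_even he.1, map_zero] using h1

theorem lowestFormOne_swap (hφ : IsOrthosymplecticForm φ) (he : e ∈ ospPart φ 0) {d : ℕ}
    (x y : lowestSpace (blockOne h) (blockOne f) d) :
    lowestFormOne φ e h f d x y = -((-1) ^ (d - 1) * lowestFormOne φ e h f d y x) := by
  rw [lowestFormOne_apply, lowestFormOne_apply, hφ.skew_odd]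
  have h1 := form_pow_apply_of_mem_even he (d - 1) ((0 : V₀), (y : V₁)) ((0 : V₀), (x : V₁))
  rw [neg_inj]
  simpa only [pow_apply_of_mem_even he.1, map_zero] using h1

variable [CharZero F] [IsAlgClosed F] [FiniteDimensional F V₀] [FiniteDimensional F V₁]

/-- A lowest weight vector of weight `1 - d` can pair nontrivially only with `e^(d-1) w'` for `w'`
of the same weight. If those pairings vanish too, it is in the radical of `φ`. -/
theorem eq_zero_of_form_lowest_eq_zero (t : EndSl2Triple e h f) (hφ : IsOrthosymplecticForm φ)
    (he : e ∈ ospPart φ 0) (hh : h ∈ ospPart φ 0) {d : ℕ} (hd : 0 < d) {w : V₀ × V₁}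
    (hw : w ∈ lowestSpace h f d)
    (h0 : ∀ w' ∈ lowestSpace h f d, φ w ((e ^ (d - 1)) w') = 0) : w = 0 := by
  have h1 : φ w = 0 := by
    refine t.eq_zero_of_forall_lowest fun d' hd' w' hw' j => ?_
    by_cases hj : d = d' ∧ j + 1 = d
    · obtain ⟨rfl, hj⟩ := hj
      rw [show j = d - 1 by omega]
      exact h0 w' hw'
    · exact form_lowest_pow_eq_zero t he hh hd hd' hw hw' hj
  exact hφ.nondegenerate.1 w fun y => by rw [h1, LinearMap.zero_apply]

theorem lowestFormZero_nondegenerate (t : EndSl2Triple e h f) (hφ : IsOrthosymplecticForm φ)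
    (he : e ∈ ospPart φ 0) (hh : h ∈ ospPart φ 0) (hf : f ∈ ospPart φ 0) {d : ℕ} (hd : 0 < d)
    (x : lowestSpace (blockZero h) (blockZero f) d)
    (hx : ∀ y, lowestFormZero φ e h f d x y = 0) : x = 0 := by
  have h1 := eq_zero_of_form_lowest_eq_zero t hφ he hh hd (w := ((x : V₀), (0 : V₁)))
    ((mem_lowestSpace_prod hh.1 hf.1).2 ⟨x.2, zero_mem _⟩) (by
      rintro ⟨a, b⟩ hab
      obtain ⟨ha, hb⟩ := (mem_lowestSpace_prod hh.1 hf.1).1 hab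
      have := form_lowest_eq hφ he x ⟨a, ha⟩ 0 ⟨b, hb⟩
      rw [hx, map_zero, LinearMap.zero_apply, add_zero] at this
      exact this)
  exact Subtype.ext (congrArg Prod.fst h1)

theorem lowestFormOne_nondegenerate (t : EndSl2Triple e h f) (hφ : IsOrthosymplecticForm φ)
    (he : e ∈ ospPart φ 0) (hh : h ∈ ospPart φ 0) (hf : f ∈ ospPart φ 0) {d : ℕ} (hd : 0 < d)
    (y : lowestSpace (blockOne h) (blockOne f) d)
    (hy : ∀ y', lowestFormOne φ e h f d y y' = 0) : y = 0 := by
  have h1 := eq_zero_of_form_lowest_eq_zero t hφ he hh hd (w := ((0 : V₀), (y : V₁)))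
    ((mem_lowestSpace_prod hh.1 hf.1).2 ⟨zero_mem _, y.2⟩) (by
      rintro ⟨a, b⟩ hab
      obtain ⟨ha, hb⟩ := (mem_lowestSpace_prod hh.1 hf.1).1 hab
      have := form_lowest_eq hφ he 0 ⟨a, ha⟩ y ⟨b, hb⟩
      rw [hy, map_zero, LinearMap.zero_apply, add_zero] at this
      exact this)
  exact Subtype.ext (congrArg Prod.snd h1)

/-- In odd dimension `d` the form induced on the lowest weight vectors is orthosymplectic. -/
theorem exists_chart_of_odd (t : EndSl2Triple e h f) (hφ : IsOrthosymplecticForm φ)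
    (he : e ∈ ospPart φ 0) (hh : h ∈ ospPart φ 0) (hf : f ∈ ospPart φ 0) {d a b : ℕ} (hd : Odd d)
    (ha : Module.finrank F (lowestSpace (blockZero h) (blockZero f) d) = a)
    (hb : Module.finrank F (lowestSpace (blockOne h) (blockOne f) d) = 2 * b) :
    ∃ ι : (Fin a → F) × (Fin b ⊕ Fin b → F) →ₗ[F] V₀ × V₁,
      IsLowestChart φ e h f d 0 ι (stdForm F a b) := by
  have hsign : (-1 : F) ^ (d - 1) = 1 := (Nat.Odd.sub_odd hd odd_one).neg_one_pow
  obtain ⟨α, hα⟩ := exists_equiv_dotProduct (lowestFormZero φ e h f d)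
    (fun x y => by rw [lowestFormZero_swap hφ he, hsign, one_mul])
    (lowestFormZero_nondegenerate t hφ he hh hf hd.pos) ha
  obtain ⟨β, hβ⟩ := exists_equiv_symplectic (lowestFormOne φ e h f d)
    (fun x y => by rw [lowestFormOne_swap hφ he, hsign, one_mul])
    (lowestFormOne_nondegenerate t hφ he hh hf hd.pos) hb
  let ι : (Fin a → F) × (Fin b ⊕ Fin b → F) →ₗ[F] V₀ × V₁ :=
    (Submodule.subtype _ ∘ₗ α.toLinearMap).prodMap (Submodule.subtype _ ∘ₗ β.toLinearMap)
  have hι : ∀ x, ι x = ((α x.1 : V₀), (β x.2 : V₁)) := fun x => rfl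
  refine ⟨ι, ?_, ?_, ?_, ?_⟩
  · intro x y hxy
    rw [hι, hι, Prod.mk.injEq] at hxy
    exact Prod.ext (α.injective (Subtype.ext hxy.1)) (β.injective (Subtype.ext hxy.2))
  · ext ⟨x, y⟩
    rw [mem_lowestSpace_prod hh.1 hf.1]
    constructor
    · rintro ⟨z, hz⟩
      rw [hι, Prod.mk.injEq] at hz
      rw [← hz.1, ← hz.2]
      exact ⟨Subtype.coe_prop _, Subtype.coe_prop _⟩
    · rintro ⟨hx, hy⟩
      exact ⟨(α.symm ⟨x, hx⟩, β.symm ⟨y, hy⟩), by simp [hι]⟩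
  · intro k x
    simp [hι, parityTwist_apply, superSign_zero_right]
  · intro x y
    rw [hι, hι, form_lowest_eq hφ he, hα, hβ, parityTwist_zero, stdForm_apply]
    rfl

/-- In even dimension `d` the form induced on the lowest weight vectors is orthosymplectic after a
change of parity. -/
theorem exists_chart_of_even (t : EndSl2Triple e h f) (hφ : IsOrthosymplecticForm φ)
    (he : e ∈ ospPart φ 0) (hh : h ∈ ospPart φ 0) (hf : f ∈ ospPart φ 0) {d a b : ℕ} (hd : Even d)
    (hpos : 0 < d) (ha : Module.finrank F (lowestSpace (blockOne h) (blockOne f) d) = a)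
    (hb : Module.finrank F (lowestSpace (blockZero h) (blockZero f) d) = 2 * b) :
    ∃ ι : (Fin a → F) × (Fin b ⊕ Fin b → F) →ₗ[F] V₀ × V₁,
      IsLowestChart φ e h f d 1 ι (stdForm F a b) := by
  have hsign : (-1 : F) ^ (d - 1) = -1 := (Nat.Even.sub_odd hpos hd odd_one).neg_one_pow
  obtain ⟨α, hα⟩ := exists_equiv_dotProduct (lowestFormOne φ e h f d)
    (fun x y => by rw [lowestFormOne_swap hφ he, hsign, neg_one_mul, neg_neg])
    (lowestFormOne_nondegenerate t hφ he hh hf hpos) ha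
  -- The minus sign compensates the twist in `IsLowestChart.form`, which for `π = 1` negates the
  -- symplectic coordinates of the first argument.
  obtain ⟨β, hβ⟩ := exists_equiv_symplectic (-lowestFormZero φ e h f d)
    (fun x y => by
      simp only [LinearMap.neg_apply]
      rw [lowestFormZero_swap hφ he, hsign, neg_one_mul])
    (fun x hx => lowestFormZero_nondegenerate t hφ he hh hf hpos x
      (fun y => neg_eq_zero.1 (hx y))) hb
  have hβ' : ∀ x y, lowestFormZero φ e h f d (β x) (β y) =
      -∑ i, (x (Sum.inl i) * y (Sum.inr i) - x (Sum.inr i) * y (Sum.inl i)) := fun x y => by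
    rw [← hβ, LinearMap.neg_apply, LinearMap.neg_apply, neg_neg]
  -- The change of parity: symplectic coordinates go to `V₀`, orthogonal ones to `V₁`.
  let ι : (Fin a → F) × (Fin b ⊕ Fin b → F) →ₗ[F] V₀ × V₁ :=
    (Submodule.subtype _ ∘ₗ β.toLinearMap ∘ₗ LinearMap.snd F _ _).prod
      (Submodule.subtype _ ∘ₗ α.toLinearMap ∘ₗ LinearMap.fst F _ _)
  have hι : ∀ x, ι x = ((β x.2 : V₀), (α x.1 : V₁)) := fun x => rfl
  refine ⟨ι, ?_, ?_, ?_, ?_⟩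
  · intro x y hxy
    rw [hι, hι, Prod.mk.injEq] at hxy
    exact Prod.ext (α.injective (Subtype.ext hxy.2)) (β.injective (Subtype.ext hxy.1))
  · ext ⟨x, y⟩
    rw [mem_lowestSpace_prod hh.1 hf.1]
    constructor
    · rintro ⟨z, hz⟩
      rw [hι, Prod.mk.injEq] at hz
      rw [← hz.1, ← hz.2]
      exact ⟨Subtype.coe_prop _, Subtype.coe_prop _⟩
    · rintro ⟨hx, hy⟩
      exact ⟨(α.symm ⟨y, hy⟩, β.symm ⟨x, hx⟩), by simp [hι]⟩
  · intro k x
    simp [hι, parityTwist_apply, smul_smul, superSign_mul_self]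
  · intro x y
    rw [hι, hι, form_lowest_eq hφ he, hα, hβ', parityTwist_apply, stdForm_apply,
      superSign_one_one, ← Finset.sum_neg_distrib, add_comm]
    congr 1
    refine Finset.sum_congr rfl fun i _ => ?_
    simp
    ring

end Charts

/-- Over an algebraically closed field of characteristic zero, let `𝔤 = 𝔬𝔰𝔭(V, φ)` with
`dim V = (m|2n)`, let `e ∈ 𝔤₀` be nilpotent with orthosymplectic partition `(p|q)` and let
`𝔰 = {e, h, f}` be an `𝔰𝔩₂`-triple of even elements. Then `𝔤^𝔰` is isomorphic to the product of
the `𝔬𝔰𝔭(m_r|2n_r)` over the distinct odd parts `r` (of multiplicity `m_r` in `p` and `2n_r` in `q`)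
and of the `𝔬𝔰𝔭(d_s|2c_s)` over the distinct even parts `s` (of multiplicity `2c_s` in `p` and `d_s`
in `q`). The divisions by two below are exact since `(p|q)` is orthosymplectic. -/
theorem mainTheorem5 {F : Type*} [Field F] [IsAlgClosed F] [CharZero F]
    {V₀ V₁ : Type*} [AddCommGroup V₀] [Module F V₀] [FiniteDimensional F V₀]
    [AddCommGroup V₁] [Module F V₁] [FiniteDimensional F V₁]
    (m n : ℕ) (hm : Module.finrank F V₀ = m) (hn : Module.finrank F V₁ = 2 * n)
    (φ : LinearMap.BilinForm F (V₀ × V₁)) (hφ : IsOrthosymplecticForm φ)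
    (p : m.Partition) (q : (2 * n).Partition) (hpq : IsOrthosymplecticPartition p q)
    (e h f : osp φ) (t : IsEvenSl2Triple F e h f)
    (hp : HasJordanType (blockZero (e : Module.End F (V₀ × V₁))) p)
    (hq : HasJordanType (blockOne (e : Module.End F (V₀ × V₁))) q) :
    Nonempty (LieSuperEquiv F t.centralizer
      ((∀ r : oddParts p q, stdOsp F (p.parts.count (r : ℕ)) (q.parts.count (r : ℕ) / 2)) ×
        (∀ s : evenParts p q,
          stdOsp F (q.parts.count (s : ℕ)) (p.parts.count (s : ℕ) / 2)))) := by
  obtain ⟨he, hh, hf⟩ := t.mem_ospPart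
  have T := t.endSl2Triple
  have hfin₀ : ∀ {d : ℕ}, 0 < d → _ :=
    (T.blockZero he.1 hh.1 hf.1).finrank_lowestSpace hp
  have hfin₁ : ∀ {d : ℕ}, 0 < d → _ :=
    (T.blockOne he.1 hh.1 hf.1).finrank_lowestSpace hq
  let d : oddParts p q ⊕ evenParts p q → ℕ := Sum.elim (fun r => r) fun s => s
  let π : oddParts p q ⊕ evenParts p q → ZMod 2 := Sum.elim (fun _ => 0) fun _ => 1
  let a : oddParts p q ⊕ evenParts p q → ℕ :=
    Sum.elim (fun r => p.parts.count (r : ℕ)) fun s => q.parts.count (s : ℕ)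
  let b : oddParts p q ⊕ evenParts p q → ℕ :=
    Sum.elim (fun r => q.parts.count (r : ℕ) / 2) fun s => p.parts.count (s : ℕ) / 2
  have hmem : ∀ k, k ∈ Set.range d ↔ k ∈ p.parts ∨ k ∈ q.parts := by
    intro k
    simp only [d, Set.Sum.elim_range, Subtype.range_coe_subtype, oddParts, evenParts,
      Finset.mem_filter, Finset.mem_union, Multiset.mem_toFinset, Set.mem_union,
      Set.mem_ofPred_eq]
    have := Nat.even_or_odd k
    tauto
  have hpos : ∀ i, 0 < d i := by
    intro i
    rcases (hmem (d i)).1 ⟨i, rfl⟩ with hi | hi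
    · exact p.parts_pos hi
    · exact q.parts_pos hi
  have hodd : ∀ r : oddParts p q, Odd (r : ℕ) := fun r => (Finset.mem_filter.1 r.2).2
  have heven : ∀ s : evenParts p q, Even (s : ℕ) := fun s => (Finset.mem_filter.1 s.2).2
  have hinj : Function.Injective d := by
    refine Function.Injective.sumElim Subtype.val_injective Subtype.val_injective fun r s hrs => ?_
    exact Nat.not_even_iff_odd.2 (hodd r) (hrs ▸ heven s)
  have hchart : ∀ i, ∃ ι : (Fin (a i) → F) × (Fin (b i) ⊕ Fin (b i) → F) →ₗ[F] V₀ × V₁,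
      IsLowestChart φ (e : Module.End F (V₀ × V₁)) h f (d i) (π i) ι (stdForm F (a i) (b i)) := by
    rintro (r | s)
    · refine exists_chart_of_odd T hφ he hh hf (hodd r) (hfin₀ (hpos (Sum.inl r))) ?_
      rw [hfin₁ (hpos (Sum.inl r))]
      change q.parts.count (r : ℕ) = 2 * (q.parts.count (r : ℕ) / 2)
      by_cases hr : (r : ℕ) ∈ q.parts
      · exact (Nat.two_mul_div_two_of_even (hpq.symplectic _ hr (hodd r))).symm
      · rw [Multiset.count_eq_zero_of_notMem hr]
    · refine exists_chart_of_even T hφ he hh hf (heven s) (hpos (Sum.inr s))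
        (hfin₁ (hpos (Sum.inr s))) ?_
      rw [hfin₀ (hpos (Sum.inr s))]
      change p.parts.count (s : ℕ) = 2 * (p.parts.count (s : ℕ) / 2)
      by_cases hs : (s : ℕ) ∈ p.parts
      · exact (Nat.two_mul_div_two_of_even (hpq.orthogonal _ hs (heven s))).symm
      · rw [Multiset.count_eq_zero_of_notMem hs]
  choose ι hι using hchart
  -- A length that is a part of neither `p` nor `q` has multiplicity zero in both, so no string is
  -- missed by the index set.
  have hbot : ∀ k, 0 < k → k ∉ Set.range d →
      lowestSpace (h : Module.End F (V₀ × V₁)) (f : Module.End F (V₀ × V₁)) k = ⊥ := by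
    intro k hk hkd
    rw [hmem, not_or] at hkd
    have h0 := hfin₀ hk
    have h1 := hfin₁ hk
    rw [Multiset.count_eq_zero_of_notMem hkd.1] at h0
    rw [Multiset.count_eq_zero_of_notMem hkd.2] at h1
    rw [Submodule.finrank_eq_zero] at h0 h1
    rw [Submodule.eq_bot_iff]
    rintro ⟨x, y⟩ hxy
    rw [mem_lowestSpace_prod hh.1 hf.1, h0, h1, Submodule.mem_bot, Submodule.mem_bot] at hxy
    rw [hxy.1, hxy.2]
    rfl
  have D : IsAdapted φ (e : Module.End F (V₀ × V₁)) (h : Module.End F (V₀ × V₁))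
      (f : Module.End F (V₀ × V₁)) d π ι (fun i => stdForm F (a i) (b i)) :=
    { triple := T
      e_mem := he
      h_mem := hh
      pos := hpos
      d_injective := hinj
      chart := hι
      bijective := ⟨T.stringMap_injective hinj (fun i => (hι i).injective)
        (fun i => (hι i).range_eq), T.stringMap_surjective hpos (fun i => (hι i).range_eq) hbot⟩ }
  obtain ⟨E⟩ := D.nonempty_equiv t
  exact ⟨E.symm.trans (LieSuperEquiv.sumPiEquivProdPi fun i => stdOsp F (a i) (b i))⟩
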